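/- **Hashing bound with decoder side information.** Label single-qubit Paulis $I,X,Y,Z$ (modulo phase) by $(x,z)=(0,0),(1,0),(1,1),(0,1)\in\mathbb F_2^2$ and $n$-qubit Paulis by $e=[x\mid z]\in\mathbb F_2^{2n}$, with symplectic product $\langle e,e'\rangle=x\cdot z'+z\cdot x' \bmod 2$. Let $\mathcal N(\rho)=\sum_{E\in\{I,X,Y,Z\}}p_E\,E\rho E$ be a memoryless Pauli channel, where $p$ is a probability distribution. Let $n\ge 1$, and take an $[\![n,k]\!]$ stabilizer code with $r=n-k$ independent commuting generators $h_1,\dots,h_r$ (the rows of $H$), pure errors $g_1,\dots,g_r$ (the rows of $G$) with $\langle h_i,g_j\rangle=\delta_{ij}$, and logical Paulis $L_X,L_Z$ ($k$ rows each) which commute with all $h_i$ and satisfy the canonical commutation relations. Let $(L,S)$ have the joint distribution $$p(a,b,s)=\sum_{t\in\mathbb F_2^r}\ \prod_{i=1}^n p_{E_i},\qquad E=tH\oplus aL_X\oplus bL_Z\oplus sG,\qquad L=(a,b),\ S=s,$$ and let $H(L\mid S)$ be the conditional Shannon entropy in bits. Then every rate $$R<R_{\mathrm{ind}}:=\frac{k-H(L\mid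 S)}{n}$$ is achievable on the original channel $\mathcal N$ by concatenating the inner code with a suitable outer stabilizer code. Precisely: the inner code has an encoding isometry $V$ under which the logical Paulis of the code act (up to sign) as the Paulis $X_j,Z_j$ of the $k$ encoded qubits, and for every such $V$ and every $\varepsilon>0$, for all sufficiently large $N$ there is an integer $m$ with $R\,Nn\le m\le Nk$ such that outer $[\![Nk,m]\!]$ stabilizer codes exist for which the following scheme is $\varepsilon$-reliable; moreover, a uniformly random outer $[\![Nk,m]\!]$ stabilizer code (uniformly random list of $Nk-m$ independent commuting generators modulo phase) has this property with probability at least $1-\varepsilon$. Scheme: encode $m$ qubits by the outer code and then each of the $N$ blocks of $k$ qubits by $V$; send the $Nn$ qubits through $\mathcal N^{\otimes Nn}$; measure the inner syndrome $s_j$ of every block, undo the pure error $s_jG$ in block $j$, and undo $V^{\otimes N}$; measure the outer syndrome $\sigma$, apply a Pauli correction on the $Nk$ qubits that depends on $(s_1,\dots,s_N)$ and $\sigma$ and has outer syndrome $\sigma$, and undo the outer encoding. It is $\varepsilon$-reliable if, for some choice of the outer encoding isometry and of the correction rule, it is a quantum channel on $m$ qubits that preserves every pure state of these qubits together with an arbitrary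 finite-dimensional reference system with fidelity at least $1-\varepsilon$. -/

import Mathlib

open scoped Matrix

noncomputable section

namespace PauliHashing

/-! ## Paulis modulo phase, and Pauli operators -/

/-- Single-qubit Pauli labels `(x, z)`: `I = (0,0)`, `X = (1,0)`, `Y = (1,1)`, `Z = (0,1)`. -/
abbrev Label : Type := ZMod 2 × ZMod 2

/-- Paulis modulo global phase on the qubits indexed by `ι`: the binary space `[x | z]`. -/
abbrev Pauli (ι : Type) : Type := ι → Label

/-- The symplectic product `x · z' + z · x'` modulo 2; it vanishes iff the Paulis commute. -/
def symp {ι : Type} [Fintype ι] (e f : Pauli ι) : ZMod 2 :=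
  ∑ i, ((e i).1 * (f i).2 + (e i).2 * (f i).1)

/-- Computational basis labels of a register of qubits indexed by `ι`. -/
abbrev Bits (ι : Type) : Type := ι → Fin 2

/-- The Hermitian single-qubit Pauli matrices `I, X, Y, Z`. -/
def pauliMat (a : Label) : Matrix (Fin 2) (Fin 2) ℂ :=
  if a.1 = 0 then (if a.2 = 0 then !![1, 0; 0, 1] else !![1, 0; 0, -1])
  else (if a.2 = 0 then !![0, 1; 1, 0] else !![0, -Complex.I; Complex.I, 0])

/-- The Hermitian Pauli operator `⨂ i, pauliMat (e i)`. -/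
def pauliOp {ι : Type} [Fintype ι] (e : Pauli ι) : Matrix (Bits ι) (Bits ι) ℂ :=
  Matrix.of fun u v => ∏ i, pauliMat (e i) (u i) (v i)

/-- The memoryless Pauli channel `ρ ↦ ∑ E, (∏ i, p (E i)) E ρ E` on the qubits `ι`. -/
def pauliChannel {ι : Type} [Fintype ι] [DecidableEq ι] (p : Label → ℝ)
    (ρ : Matrix (Bits ι) (Bits ι) ℂ) : Matrix (Bits ι) (Bits ι) ℂ :=
  ∑ e : Pauli ι, ((∏ i, p (e i) : ℝ) : ℂ) • (pauliOp e * ρ * pauliOp e)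

/-! ## Stabilizer codes and tableaux -/

/-- A stabilizer code on the qubits `ι`, given by `r` independent commuting generators. If `ι` has
`n` elements, it encodes `n - r` qubits. -/
structure StabilizerCode (ι : Type) [Fintype ι] (r : ℕ) where
  /-- the stabilizer generators (the rows of the check matrix) -/
  gen : Fin r → Pauli ι
  gen_comm : ∀ i j, symp (gen i) (gen j) = 0
  gen_indep : LinearIndependent (ZMod 2) gen

/-- The syndrome `s_i = ⟨e, h_i⟩` of a Pauli error. -/
def StabilizerCode.syndrome {ι : Type} [Fintype ι] {r : ℕ} (C : StabilizerCode ι r)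
    (e : Pauli ι) : Fin r → ZMod 2 :=
  fun i => symp e (C.gen i)

/-- `V` is an isometry from `k` qubits into a joint eigenspace of the generators. The eigenvalues
(signs of the generators) are arbitrary, as the labels only fix Paulis up to phase. When
`k = |ι| - r` the range of `V` is the entire eigenspace. -/
def StabilizerCode.IsEncoder {ι : Type} [Fintype ι] [DecidableEq ι] {r k : ℕ}
    (C : StabilizerCode ι r) (V : Matrix (Bits ι) (Bits (Fin k)) ℂ) : Prop :=
  Vᴴ * V = 1 ∧ ∀ i, pauliOp (C.gen i) * V = V ∨ pauliOp (C.gen i) * V = -V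

/-- Completion of the generators of an `[[n, k]]` code (with `r = n - k` generators) to a tableau:
pure errors dual to the generators, and logical Paulis which commute with the generators and
satisfy the canonical commutation relations. No relation among the pure errors, or between pure
errors and logical Paulis, is required; in particular every symplectic basis qualifies. -/
structure Tableau {n r : ℕ} (C : StabilizerCode (Fin n) r) (k : ℕ) where
  /-- the pure errors `G` -/
  pure : Fin r → Pauli (Fin n)
  /-- the logical `X` operators -/
  logX : Fin k → Pauli (Fin n)
  /-- the logical `Z` operators -/
  logZ : Fin k → Pauli (Fin n)
  gen_pure : ∀ i j, symp (C.gen i) (pure j) = if i = j then 1 else 0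
  gen_logX : ∀ i j, symp (C.gen i) (logX j) = 0
  gen_logZ : ∀ i j, symp (C.gen i) (logZ j) = 0
  logX_logX : ∀ i j, symp (logX i) (logX j) = 0
  logZ_logZ : ∀ i j, symp (logZ i) (logZ j) = 0
  logX_logZ : ∀ i j, symp (logX i) (logZ j) = if i = j then 1 else 0

namespace Tableau

variable {n r k : ℕ} {C : StabilizerCode (Fin n) r}

/-- The physical Pauli `tH ⊕ aL_X ⊕ bL_Z ⊕ sG`, where `l j = (a j, b j)`. -/
def assemble (T : Tableau C k) (t : Fin r → ZMod 2) (l : Pauli (Fin k)) (s : Fin r → ZMod 2) :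
    Pauli (Fin n) :=
  ∑ i, t i • C.gen i + ∑ j, (l j).1 • T.logX j + ∑ j, (l j).2 • T.logZ j + ∑ i, s i • T.pure i

/-- The induced joint pmf `p(L, S)` of logical Pauli error and syndrome, for i.i.d. physical Pauli
errors with single-qubit distribution `p`. -/
def joint (T : Tableau C k) (p : Label → ℝ) (l : Pauli (Fin k)) (s : Fin r → ZMod 2) : ℝ :=
  ∑ t : Fin r → ZMod 2, ∏ i, p (T.assemble t l s i)

/-- The syndrome marginal `p(S)`. -/
def marginal (T : Tableau C k) (p : Label → ℝ) (s : Fin r → ZMod 2) : ℝ :=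
  ∑ l : Pauli (Fin k), T.joint p l s

/-- The conditional Shannon entropy `H(L | S)` in bits. -/
def condEntropy (T : Tableau C k) (p : Label → ℝ) : ℝ :=
  -∑ s : Fin r → ZMod 2, ∑ l : Pauli (Fin k),
    T.joint p l s * Real.logb 2 (T.joint p l s / T.marginal p s)

/-- The induced hashing rate `(k - H(L | S)) / n`. -/
def inducedRate (T : Tableau C k) (p : Label → ℝ) : ℝ :=
  ((k : ℝ) - T.condEntropy p) / n

/-- `V` encodes `k` logical qubits into the code such that the logical Paulis of the tableau act
(up to sign) as the Pauli operators `X_j`, `Z_j` of the logical qubits. -/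
def IsEncoder (T : Tableau C k) (V : Matrix (Bits (Fin n)) (Bits (Fin k)) ℂ) : Prop :=
  C.IsEncoder V ∧
  (∀ j, pauliOp (T.logX j) * V = V * pauliOp (Pi.single j ((1, 0) : Label)) ∨
    pauliOp (T.logX j) * V = -(V * pauliOp (Pi.single j ((1, 0) : Label)))) ∧
  (∀ j, pauliOp (T.logZ j) * V = V * pauliOp (Pi.single j ((0, 1) : Label)) ∨
    pauliOp (T.logZ j) * V = -(V * pauliOp (Pi.single j ((0, 1) : Label))))

end Tableau

/-! ## Quantum channels and entanglement fidelity -/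

/-- The operators `K a` are the Kraus operators of a (trace-preserving) quantum channel. -/
def IsChannel {A X Y : Type} [Fintype A] [Fintype Y] [Fintype X] [DecidableEq X]
    (K : A → Matrix Y X ℂ) : Prop :=
  ∑ a, (K a)ᴴ * K a = 1

/-- The map `ρ ↦ ∑ a, K a ρ (K a)ᴴ`. -/
def applyKraus {A X Y : Type} [Fintype A] [Fintype X] (K : A → Matrix Y X ℂ)
    (ρ : Matrix X X ℂ) : Matrix Y Y ℂ :=
  ∑ a, K a * ρ * (K a)ᴴ

/-- `id ⊗ Φ`, with a reference system of dimension `d`, for a linear map `Φ`. -/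
def withReference {X Y : Type} (d : ℕ) (Φ : Matrix X X ℂ → Matrix Y Y ℂ)
    (M : Matrix (Fin d × X) (Fin d × X) ℂ) : Matrix (Fin d × Y) (Fin d × Y) ℂ :=
  Matrix.of fun u v => Φ (Matrix.of fun x y => M (u.1, x) (v.1, y)) u.2 v.2

/-- Every pure state of the system and an arbitrary finite-dimensional reference system is
preserved by `id ⊗ Φ` with fidelity `⟨ψ| (id ⊗ Φ)(|ψ⟩⟨ψ|) |ψ⟩` at least `f`. -/
def FidelityAtLeast {X : Type} [Fintype X] (Φ : Matrix X X ℂ → Matrix X X ℂ) (f : ℝ) : Prop :=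
  ∀ (d : ℕ) (ψ : Fin d × X → ℂ), ∑ u, ‖ψ u‖ ^ 2 = 1 →
    f ≤ (star ψ ⬝ᵥ (withReference d Φ (Matrix.vecMulVec ψ (star ψ)) *ᵥ ψ)).re

/-! ## Concatenation -/

/-- `V ⊗ ⋯ ⊗ V`, acting on `N` blocks. -/
def blockPow {n k : ℕ} (N : ℕ) (V : Matrix (Bits (Fin n)) (Bits (Fin k)) ℂ) :
    Matrix (Bits (Fin N × Fin n)) (Bits (Fin N × Fin k)) ℂ :=
  Matrix.of fun u v => ∏ b, V (fun i => u (b, i)) (fun j => v (b, j))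

/-- Encoder of the concatenated code: the outer encoder `W`, and then the inner encoder `V` on each
of the `N` blocks. -/
def concatEncoder {n k N m : ℕ} (V : Matrix (Bits (Fin n)) (Bits (Fin k)) ℂ)
    (W : Matrix (Bits (Fin N × Fin k)) (Bits (Fin m)) ℂ) :
    Matrix (Bits (Fin N × Fin n)) (Bits (Fin m)) ℂ :=
  blockPow N V * W

/-- The pure error with inner syndromes `s`: it is `s_b G` on block `b`. -/
def blockPure {n r k : ℕ} {C : StabilizerCode (Fin n) r} (T : Tableau C k) {N : ℕ}
    (s : Fin N → Fin r → ZMod 2) : Pauli (Fin N × Fin n) :=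
  fun q => (∑ i, s q.1 i • T.pure i) q.2

/-- Kraus operators of the inner decoder, indexed by its classical output, the inner syndromes `s`
of all blocks: upon syndromes `s`, undo the pure error `s_b G` in each block `b`, which leads back
to the inner code space, and undo the inner encoding. (The adjoint of the encoder vanishes off the
code space, hence this operator vanishes off the subspace with syndromes `s`, and no projection
onto that subspace has to be written.) -/
def innerDecoder {n r k : ℕ} {C : StabilizerCode (Fin n) r} (T : Tableau C k) {N : ℕ}
    (V : Matrix (Bits (Fin n)) (Bits (Fin k)) ℂ) (s : Fin N → Fin r → ZMod 2) :
    Matrix (Bits (Fin N × Fin k)) (Bits (Fin N × Fin n)) ℂ :=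
  (blockPow N V)ᴴ * pauliOp (blockPure T s)

/-- Kraus operators of the full decoder, indexed by the inner syndromes `s` and the outer syndrome
`σ`: after the inner decoder, measure the outer syndrome `σ`, apply the logical Pauli correction
`c s σ`, which depends on both and leads back to the outer code space, and undo the outer
encoding. -/
def concatDecoder {n r k : ℕ} {C : StabilizerCode (Fin n) r} (T : Tableau C k) {N m q : ℕ}
    (V : Matrix (Bits (Fin n)) (Bits (Fin k)) ℂ)
    (W : Matrix (Bits (Fin N × Fin k)) (Bits (Fin m)) ℂ)
    (c : (Fin N → Fin r → ZMod 2) → (Fin q → ZMod 2) → Pauli (Fin N × Fin k)) :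
    (Fin N → Fin r → ZMod 2) × (Fin q → ZMod 2) →
      Matrix (Bits (Fin m)) (Bits (Fin N × Fin n)) ℂ :=
  fun a => Wᴴ * pauliOp (c a.1 a.2) * innerDecoder T V a.1

/-- The outer code `D` on the `N k` logical qubits, concatenated with the inner transform
`(T, V)`, transmits `m` qubits over `N n` uses of the physical Pauli channel `p` with fidelity at
least `1 - ε`, for some encoder `W` of `D` and some Pauli correction rule `c` that depends on the
inner syndromes and on the outer syndrome. -/
def Reliable {n r k : ℕ} {C : StabilizerCode (Fin n) r} (p : Label → ℝ) (T : Tableau C k)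
    (V : Matrix (Bits (Fin n)) (Bits (Fin k)) ℂ) {N q : ℕ} (m : ℕ)
    (D : StabilizerCode (Fin N × Fin k) q) (ε : ℝ) : Prop :=
  ∃ (W : Matrix (Bits (Fin N × Fin k)) (Bits (Fin m)) ℂ)
    (c : (Fin N → Fin r → ZMod 2) → (Fin q → ZMod 2) → Pauli (Fin N × Fin k)),
    D.IsEncoder W ∧
    (∀ s σ, D.syndrome (c s σ) = σ) ∧
    IsChannel (concatDecoder T V W c) ∧
    FidelityAtLeast
      (fun ρ => applyKraus (concatDecoder T V W c)
        (pauliChannel p (concatEncoder V W * ρ * (concatEncoder V W)ᴴ)))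
      (1 - ε)

end PauliHashing

end

noncomputable section
namespace PauliHashing

/-! ## The symplectic form -/

section Symp
variable {ι : Type} [Fintype ι]

/-! The proof is a random coding argument for the channel that the inner code induces on its logical
qubits. A physical Pauli on `N` blocks has unique tableau coordinates: a stabilizer part `t`, a
logical part `l` and a pure error with syndrome `s`. On encoded states it acts, up to phase, as `l`
followed by that pure error (`pauliOp_blockAssemble_mul`). The inner decoder learns `s`, removes the
pure error and leaves `l`. Summing out `t` gives the law of `(l, s)`: independent blocks, each
distributed as `joint`. So the outer code faces a Pauli error `l` with `s` as side information.

Every product of a decoder branch, a physical Pauli and the encoder is one Kraus operator of the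
whole scheme. It is a phase times the identity whenever correction plus logical error lies in the
outer stabilizer, and the other terms contribute nonnegatively to the fidelity. Hence the fidelity
is at least the classical probability of correct decoding, uniformly in the input and the reference
(`fidelityAtLeast_concat`).

The decoder picks a logical error that is typical given `s` and has the observed outer syndrome. It
can fail in two ways only. The true error may be atypical, with probability `O(1/N)` by Chebyshev
(`sum_atypical_le`). Or another typical error has the same outer syndrome. There are at most `2 ^ (N
(H + δ))` typical errors (`card_typical_le`), and a nonzero Pauli goes undetected by at most a
fraction `2 ^ (-q)` of the codes with `q` generators (`card_undetecting_mul_le`), because symplectic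
transvections act transitively on nonzero Paulis. With `q` about `N (k - R n)`, which exceeds `N (H
+ δ)` by about `N δ`, the mean failure probability tends to zero, and Markov's inequality turns this
into a statement about most codes. -/

lemma symp_add_left (e e' f : Pauli ι) : symp (e + e') f = symp e f + symp e' f := by
  simp only [symp, ← Finset.sum_add_distrib]
  refine Finset.sum_congr rfl fun i _ => ?_
  simp only [Pi.add_apply, Prod.fst_add, Prod.snd_add]; ring

lemma symp_smul_left (c : ZMod 2) (e f : Pauli ι) : symp (c • e) f = c * symp e f := by
  simp only [symp, Finset.mul_sum]
  refine Finset.sum_congr rfl fun i _ => ?_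
  simp only [Pi.smul_apply, Prod.smul_fst, Prod.smul_snd, smul_eq_mul]; ring

lemma symp_comm (e f : Pauli ι) : symp e f = symp f e := by
  simp only [symp]
  refine Finset.sum_congr rfl fun i _ => ?_
  ring

lemma symp_add_right (e f f' : Pauli ι) : symp e (f + f') = symp e f + symp e f' := by
  rw [symp_comm, symp_add_left, symp_comm f, symp_comm f']

lemma symp_smul_right (c : ZMod 2) (e f : Pauli ι) : symp e (c • f) = c * symp e f := by
  rw [symp_comm, symp_smul_left, symp_comm f]

/-- The symplectic product as a bilinear map. -/
def sympForm (ι : Type) [Fintype ι] : Pauli ι →ₗ[ZMod 2] Pauli ι →ₗ[ZMod 2] ZMod 2 :=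
  LinearMap.mk₂ (ZMod 2) symp symp_add_left symp_smul_left symp_add_right symp_smul_right

lemma sympForm_apply (e f : Pauli ι) : sympForm ι e f = symp e f := rfl

lemma symp_zero_left (f : Pauli ι) : symp 0 f = 0 := by
  rw [← sympForm_apply, map_zero, LinearMap.zero_apply]

lemma symp_sum_left {κ : Type} (s : Finset κ) (e : κ → Pauli ι) (f : Pauli ι) :
    symp (∑ j ∈ s, e j) f = ∑ j ∈ s, symp (e j) f := by
  simp only [← sympForm_apply, map_sum, LinearMap.sum_apply]

lemma symp_sum_right {κ : Type} (s : Finset κ) (e : Pauli ι) (f : κ → Pauli ι) :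
    symp e (∑ j ∈ s, f j) = ∑ j ∈ s, symp e (f j) := by
  simp only [← sympForm_apply, map_sum]

lemma symp_self (e : Pauli ι) : symp e e = 0 := by
  simp only [symp]
  refine Finset.sum_eq_zero fun i _ => ?_
  rw [mul_comm]; exact CharTwo.add_self_eq_zero _

lemma symp_single [DecidableEq ι] (e : Pauli ι) (i : ι) (a : Label) :
    symp e (Pi.single i a) = (e i).1 * a.2 + (e i).2 * a.1 := by
  rw [symp, Finset.sum_eq_single i]
  · simp
  · intro j _ hj; simp [Pi.single_eq_of_ne hj]
  · simp

/-- Nondegeneracy: pairing with `Z` on qubit `i` reads off the `x` bit of `e i`, and pairing with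
`X` reads off its `z` bit. -/
lemma eq_zero_of_symp_eq_zero [DecidableEq ι] {e : Pauli ι} (h : ∀ f, symp e f = 0) : e = 0 := by
  funext i
  have h1 := h (Pi.single i (0, 1))
  have h2 := h (Pi.single i (1, 0))
  rw [symp_single] at h1 h2
  ext <;> simp_all

end Symp

lemma zmod_two_cases (a : ZMod 2) : a = 0 ∨ a = 1 := by
  revert a; decide

/-! ## Tensor products of families of matrices -/

section Tensor
variable {ι α β γ : Type} [Fintype ι]

/-- The tensor product of a family of matrices. -/
def tens (M : ι → Matrix α β ℂ) : Matrix (ι → α) (ι → β) ℂ :=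
  Matrix.of fun u v => ∏ i, M i (u i) (v i)

lemma tens_mul [DecidableEq ι] [Fintype β] (M : ι → Matrix α β ℂ) (M' : ι → Matrix β γ ℂ) :
    tens M * tens M' = tens fun i => M i * M' i := by
  ext u v
  simp only [tens, Matrix.mul_apply, Matrix.of_apply, Finset.prod_univ_sum,
    Finset.prod_mul_distrib, Fintype.piFinset_univ]

lemma tens_conjTranspose (M : ι → Matrix α β ℂ) : (tens M)ᴴ = tens fun i => (M i)ᴴ := by
  ext u v
  simp [tens, Matrix.conjTranspose_apply]

lemma tens_smul (c : ι → ℂ) (M : ι → Matrix α β ℂ) :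
    (tens fun i => c i • M i) = (∏ i, c i) • tens M := by
  ext u v
  simp [tens, Finset.prod_mul_distrib]

lemma tens_one [DecidableEq α] : (tens fun _ : ι => (1 : Matrix α α ℂ)) = 1 := by
  classical
  ext u v
  simp only [tens, Matrix.of_apply, Matrix.one_apply, Finset.prod_ite_zero, funext_iff]
  simp

lemma tens_eq_zero {M : ι → Matrix α β ℂ} {i : ι} (h : M i = 0) : tens M = 0 := by
  ext u v
  exact Finset.prod_eq_zero (Finset.mem_univ i) (by rw [h]; rfl)

end Tensor

/-! ## Equality up to phase -/

/-- Equality of matrices up to a global phase. -/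
def PhaseEq {X Y : Type} (A B : Matrix X Y ℂ) : Prop :=
  ∃ φ : ℂ, ‖φ‖ = 1 ∧ A = φ • B

namespace PhaseEq
variable {X Y Z : Type} {A A' B B' C : Matrix X Y ℂ}

lemma refl (A : Matrix X Y ℂ) : PhaseEq A A := ⟨1, by simp, by simp⟩

lemma symm (h : PhaseEq A B) : PhaseEq B A := by
  obtain ⟨φ, h1, rfl⟩ := h
  have : φ ≠ 0 := by rintro rfl; simp at h1
  exact ⟨φ⁻¹, by simp [h1], by rw [smul_smul, inv_mul_cancel₀ this, one_smul]⟩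

lemma trans (h : PhaseEq A B) (h' : PhaseEq B C) : PhaseEq A C := by
  obtain ⟨φ, h1, rfl⟩ := h
  obtain ⟨φ', h1', rfl⟩ := h'
  exact ⟨φ * φ', by simp [h1, h1'], by rw [smul_smul]⟩

lemma mul [Fintype Y] {A B : Matrix X Y ℂ} {A' B' : Matrix Y Z ℂ} (h : PhaseEq A B)
    (h' : PhaseEq A' B') : PhaseEq (A * A') (B * B') := by
  obtain ⟨φ, h1, rfl⟩ := h
  obtain ⟨φ', h1', rfl⟩ := h'
  exact ⟨φ * φ', by simp [h1, h1'], by rw [Matrix.smul_mul, Matrix.mul_smul, smul_smul]⟩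

lemma conjTranspose (h : PhaseEq A B) : PhaseEq Aᴴ Bᴴ := by
  obtain ⟨φ, h1, rfl⟩ := h
  exact ⟨star φ, by simp [h1], by rw [Matrix.conjTranspose_smul]⟩

lemma eq_zero (h : PhaseEq A B) (hB : B = 0) : A = 0 := by
  obtain ⟨φ, -, rfl⟩ := h
  rw [hB, smul_zero]

lemma of_sign (h : A = B ∨ A = -B) : PhaseEq A B := by
  rcases h with rfl | rfl
  · exact refl _
  · exact ⟨-1, by simp, by simp⟩

lemma tens {ι : Type} [Fintype ι] {A B : ι → Matrix X Y ℂ} (h : ∀ i, PhaseEq (A i) (B i)) :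
    PhaseEq (tens A) (tens B) := by
  choose φ h1 h2 using h
  refine ⟨∏ i, φ i, by simp [h1], ?_⟩
  rw [← tens_smul]
  exact congrArg _ (funext h2)

lemma submatrix {X' Y' : Type} (h : PhaseEq A B) (f : X' → X) (g : Y' → Y) :
    PhaseEq (A.submatrix f g) (B.submatrix f g) := by
  obtain ⟨φ, h1, rfl⟩ := h
  exact ⟨φ, h1, rfl⟩

end PhaseEq

/-! ## Algebra of Pauli operators -/

lemma pauliMat_conjTranspose (a : Label) : (pauliMat a)ᴴ = pauliMat a := by
  obtain ⟨x, z⟩ := a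
  rcases zmod_two_cases x with rfl | rfl <;> rcases zmod_two_cases z with rfl | rfl <;>
    ext i j <;> fin_cases i <;> fin_cases j <;> simp [pauliMat, Matrix.conjTranspose_apply]

lemma pauliMat_zero : pauliMat 0 = 1 := by
  simp [pauliMat, Matrix.one_fin_two]

lemma pauliMat_mul_self (a : Label) : pauliMat a * pauliMat a = 1 := by
  obtain ⟨x, z⟩ := a
  rcases zmod_two_cases x with rfl | rfl <;> rcases zmod_two_cases z with rfl | rfl <;>
    simp [pauliMat, Matrix.one_fin_two]

/-- The sign `(-1)^a`. -/
def sgn (a : ZMod 2) : ℂ := if a = 0 then 1 else -1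

lemma sgn_zero : sgn 0 = 1 := if_pos rfl

lemma sgn_one : sgn 1 = -1 := if_neg one_ne_zero

lemma sgn_add (a b : ZMod 2) : sgn (a + b) = sgn a * sgn b := by
  rcases zmod_two_cases a with rfl | rfl <;> rcases zmod_two_cases b with rfl | rfl <;>
    simp [sgn, CharTwo.add_self_eq_zero]

lemma sgn_sum {ι : Type} (s : Finset ι) (f : ι → ZMod 2) :
    sgn (∑ i ∈ s, f i) = ∏ i ∈ s, sgn (f i) := by
  classical
  induction s using Finset.induction_on with
  | empty => simp [sgn]
  | insert i s hi ih => rw [Finset.sum_insert hi, Finset.prod_insert hi, sgn_add, ih]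

lemma pauliMat_mul_comm (a b : Label) :
    pauliMat a * pauliMat b = sgn (a.1 * b.2 + a.2 * b.1) • (pauliMat b * pauliMat a) := by
  obtain ⟨x, z⟩ := a
  obtain ⟨x', z'⟩ := b
  rcases zmod_two_cases x with rfl | rfl <;> rcases zmod_two_cases z with rfl | rfl <;>
    rcases zmod_two_cases x' with rfl | rfl <;> rcases zmod_two_cases z' with rfl | rfl <;>
    simp [pauliMat, sgn, CharTwo.add_self_eq_zero]

lemma pauliMat_mul (a b : Label) : PhaseEq (pauliMat a * pauliMat b) (pauliMat (a + b)) := by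
  have h11 : (1 : ZMod 2) + 1 = 0 := rfl
  obtain ⟨x, z⟩ := a
  obtain ⟨x', z'⟩ := b
  rcases zmod_two_cases x with rfl | rfl <;> rcases zmod_two_cases z with rfl | rfl <;>
    rcases zmod_two_cases x' with rfl | rfl <;> rcases zmod_two_cases z' with rfl | rfl <;>
    first
    | (refine ⟨1, by simp, ?_⟩; simp [pauliMat, h11]; done)
    | (refine ⟨Complex.I, by simp, ?_⟩; simp [pauliMat, h11]; done)
    | (refine ⟨-Complex.I, by simp, ?_⟩; simp [pauliMat, h11])

section PauliOp
variable {ι : Type} [Fintype ι]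

lemma pauliOp_eq_tens (e : Pauli ι) : pauliOp e = tens fun i => pauliMat (e i) := rfl

lemma pauliOp_conjTranspose (e : Pauli ι) : (pauliOp e)ᴴ = pauliOp e := by
  rw [pauliOp_eq_tens, tens_conjTranspose]
  simp only [pauliMat_conjTranspose]

lemma pauliOp_zero : pauliOp (0 : Pauli ι) = 1 := by
  rw [pauliOp_eq_tens]
  simp only [Pi.zero_apply, pauliMat_zero, tens_one]

variable [DecidableEq ι]

lemma pauliOp_mul_self (e : Pauli ι) : pauliOp e * pauliOp e = 1 := by
  rw [pauliOp_eq_tens, tens_mul]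
  simp only [pauliMat_mul_self, tens_one]

lemma pauliOp_mul_comm (e f : Pauli ι) :
    pauliOp e * pauliOp f = sgn (symp e f) • (pauliOp f * pauliOp e) := by
  simp only [pauliOp_eq_tens, tens_mul, symp, sgn_sum, ← tens_smul, ← pauliMat_mul_comm]

lemma pauliOp_mul (e f : Pauli ι) : PhaseEq (pauliOp e * pauliOp f) (pauliOp (e + f)) := by
  simp only [pauliOp_eq_tens, tens_mul]
  exact PhaseEq.tens fun i => pauliMat_mul _ _

lemma pauliOp_commute {e f : Pauli ι} (h : symp e f = 0) :
    pauliOp e * pauliOp f = pauliOp f * pauliOp e := by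
  rw [pauliOp_mul_comm, h, sgn_zero, one_smul]

/-- Pauli operators are Hermitian and the eigenvalue is a real sign, so the eigenvalue equation
passes to the adjoint. Naming the sign `s` treats both cases at once. -/
lemma conjTranspose_mul_of_sign {Y : Type} {V : Matrix (Bits ι) Y ℂ} {h : Pauli ι}
    (hV : pauliOp h * V = V ∨ pauliOp h * V = -V) :
    ∃ s : ℂ, s * s = 1 ∧ pauliOp h * V = s • V ∧ Vᴴ * pauliOp h = s • Vᴴ := by
  rcases hV with hV | hV
  · refine ⟨1, by simp, by simpa using hV, ?_⟩
    have := congrArg Matrix.conjTranspose hV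
    rw [Matrix.conjTranspose_mul, pauliOp_conjTranspose] at this
    simpa using this
  · refine ⟨-1, by simp, by simpa using hV, ?_⟩
    have := congrArg Matrix.conjTranspose hV
    rw [Matrix.conjTranspose_mul, pauliOp_conjTranspose] at this
    simpa using this

/-- A Pauli error that anticommutes with a stabilizer maps the code space to an orthogonal one. -/
lemma conjTranspose_pauliOp_mul_eq_zero {Y : Type} {V : Matrix (Bits ι) Y ℂ}
    {h e : Pauli ι} (hV : pauliOp h * V = V ∨ pauliOp h * V = -V) (he : symp e h ≠ 0) :
    Vᴴ * pauliOp e * V = 0 := by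
  obtain ⟨s, hs, h1, h2⟩ := conjTranspose_mul_of_sign hV
  have he1 : symp e h = 1 := (zmod_two_cases _).resolve_left he
  -- The stabilizer `h` can be absorbed into `V` on the right or into `Vᴴ` on the left. Both yield
  -- the same multiple `s`, while exchanging `h` and `e` costs a minus sign.
  have key : Vᴴ * (pauliOp e * pauliOp h) * V = -(Vᴴ * (pauliOp h * pauliOp e) * V) := by
    rw [pauliOp_mul_comm, he1, sgn_one]; simp
  have hl : Vᴴ * (pauliOp e * pauliOp h) * V = s • (Vᴴ * pauliOp e * V) := by
    rw [← Matrix.mul_assoc, Matrix.mul_assoc, h1, Matrix.mul_smul]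
  have hr : Vᴴ * (pauliOp h * pauliOp e) * V = s • (Vᴴ * pauliOp e * V) := by
    rw [← Matrix.mul_assoc, h2, Matrix.smul_mul, Matrix.smul_mul]
  rw [hl, hr] at key
  have h0 : s • (Vᴴ * pauliOp e * V) = 0 := by
    have h2 : (2 : ℂ) • (s • (Vᴴ * pauliOp e * V)) = 0 := by
      rw [two_smul]; nth_rewrite 1 [key]; exact neg_add_cancel _
    exact (smul_eq_zero.mp h2).resolve_left two_ne_zero
  have hs0 : s ≠ 0 := by rintro rfl; simp at hs
  exact (smul_eq_zero.mp h0).resolve_left hs0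

/-- Orthogonal translates of an isometry by Paulis which fill the space by dimension are
complete. -/
lemma sum_pauliOp_translates_eq_one {S Y : Type} [Fintype S] [DecidableEq S] [Fintype Y]
    [DecidableEq Y]
    {V : Matrix (Bits ι) Y ℂ} (hV : Vᴴ * V = 1) (c : S → Pauli ι)
    (hc : ∀ s s', s ≠ s' → Vᴴ * pauliOp (c s) * (pauliOp (c s') * V) = 0)
    (hcard : Fintype.card S * Fintype.card Y = Fintype.card (Bits ι)) :
    ∑ s, pauliOp (c s) * V * (Vᴴ * pauliOp (c s)) = 1 := by
  -- The translates side by side form one matrix with orthonormal columns. By `hcard` it is square,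
  -- so its left inverse is also a right inverse.
  let U : Matrix (Bits ι) (S × Y) ℂ := Matrix.of fun u a => (pauliOp (c a.1) * V) u a.2
  have hU : Uᴴ * U = 1 := by
    ext ⟨s, y⟩ ⟨s', y'⟩
    have h1 : (Uᴴ * U) (s, y) (s', y')
        = (Vᴴ * pauliOp (c s) * (pauliOp (c s') * V)) y y' := by
      have : Vᴴ * pauliOp (c s) = (pauliOp (c s) * V)ᴴ := by
        rw [Matrix.conjTranspose_mul, pauliOp_conjTranspose]
      rw [this]; rfl
    rw [h1]
    by_cases hs : s = s'
    · subst hs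
      rw [Matrix.mul_assoc, ← Matrix.mul_assoc (pauliOp (c s)), pauliOp_mul_self, Matrix.one_mul,
        hV]
      simp [Matrix.one_apply]
    · rw [hc s s' hs]; simp [hs]
  have hU' : U * Uᴴ = 1 :=
    (Matrix.mul_eq_one_comm_of_card_eq _ _ _ (by rw [Fintype.card_prod, hcard])).mp hU
  rw [← hU']
  ext u v
  have h2 : ∀ s, pauliOp (c s) * V * (Vᴴ * pauliOp (c s))
      = (pauliOp (c s) * V) * (pauliOp (c s) * V)ᴴ := by
    intro s; rw [Matrix.conjTranspose_mul, pauliOp_conjTranspose]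
  simp only [h2, Matrix.sum_apply]
  rw [Matrix.mul_apply (M := U), Fintype.sum_prod_type]
  rfl

/-- The pairs of a physical Pauli `e` and a logical Pauli `f` such that `e` acts as `f`, up to
phase, on the range of `V`. -/
def implements {κ : Type} [Fintype κ] [DecidableEq κ] (V : Matrix (Bits ι) (Bits κ) ℂ) :
    Submodule (ZMod 2) (Pauli ι × Pauli κ) where
  carrier := {a | PhaseEq (pauliOp a.1 * V) (V * pauliOp a.2)}
  zero_mem' := by
    simp only [Set.mem_ofPred_eq, Prod.fst_zero, Prod.snd_zero, pauliOp_zero, Matrix.one_mul,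
      Matrix.mul_one]
    exact PhaseEq.refl _
  add_mem' := by
    rintro ⟨e, f⟩ ⟨e', f'⟩ h h'
    refine ((pauliOp_mul e e').symm.mul (PhaseEq.refl V)).trans ?_
    refine PhaseEq.trans ?_ ((PhaseEq.refl V).mul (pauliOp_mul f f'))
    have h1 := (PhaseEq.refl (pauliOp e)).mul h'
    have h2 := PhaseEq.mul h (PhaseEq.refl (pauliOp f'))
    simp only [← Matrix.mul_assoc] at h1 h2 ⊢
    exact h1.trans h2
  smul_mem' := by
    rintro c a h
    rcases zmod_two_cases c with rfl | rfl
    · simp only [zero_smul, Set.mem_ofPred_eq, Prod.fst_zero, Prod.snd_zero, pauliOp_zero,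
        Matrix.one_mul, Matrix.mul_one]
      exact PhaseEq.refl _
    · rwa [one_smul]

lemma mem_implements {κ : Type} [Fintype κ] [DecidableEq κ] {V : Matrix (Bits ι) (Bits κ) ℂ}
    {e : Pauli ι} {f : Pauli κ} :
    (e, f) ∈ implements V ↔ PhaseEq (pauliOp e * V) (V * pauliOp f) := Iff.rfl

end PauliOp

/-! ## Existence of encoders -/

/-- Splitting the space successively into eigenspaces of commuting involutions, and keeping the
larger half each time. -/
lemma exists_common_eigenspace {E κ : Type} [AddCommGroup E] [Module ℂ E] [FiniteDimensional ℂ E]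
    (A : κ → Module.End ℂ E) (hA : ∀ j v, A j (A j v) = v)
    (hc : ∀ i j v, A i (A j v) = A j (A i v)) (s : Finset κ) :
    ∃ U : Submodule ℂ E, Module.finrank ℂ E ≤ 2 ^ s.card * Module.finrank ℂ U ∧
      (∀ j, ∀ v ∈ U, A j v ∈ U) ∧
      ∀ j ∈ s, (∀ v ∈ U, A j v = v) ∨ (∀ v ∈ U, A j v = -v) := by
  classical
  induction s using Finset.induction_on with
  | empty => exact ⟨⊤, by simp, by simp, by simp⟩
  | insert a s ha ih =>
    obtain ⟨U, hU, hinv, hs⟩ := ih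
    set Up := U ⊓ LinearMap.ker (A a - 1) with hUp
    set Um := U ⊓ LinearMap.ker (A a + 1) with hUm
    have mp : ∀ v, v ∈ Up ↔ v ∈ U ∧ A a v = v := by
      intro v; simp [hUp, sub_eq_zero]
    have mm : ∀ v, v ∈ Um ↔ v ∈ U ∧ A a v = -v := by
      intro v; simp [hUm, add_eq_zero_iff_eq_neg]
    have hle : U ≤ Up ⊔ Um := by
      intro v hv
      have e : v = (2⁻¹ : ℂ) • (v + A a v) + (2⁻¹ : ℂ) • (v - A a v) := by
        rw [← smul_add, add_add_sub_cancel, ← two_smul ℂ v, smul_smul]; norm_num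
      rw [e]
      refine Submodule.add_mem_sup ?_ ?_
      · rw [mp]
        refine ⟨U.smul_mem _ (U.add_mem hv (hinv a v hv)), ?_⟩
        rw [map_smul, map_add, hA, add_comm]
      · rw [mm]
        refine ⟨U.smul_mem _ (U.sub_mem hv (hinv a v hv)), ?_⟩
        rw [map_smul, map_sub, hA, ← smul_neg, neg_sub]
    have hdim : Module.finrank ℂ U ≤ Module.finrank ℂ Up + Module.finrank ℂ Um :=
      (Submodule.finrank_mono hle).trans (Submodule.finrank_add_le_finrank_add_finrank Up Um)
    have hcard : (insert a s).card = s.card + 1 := Finset.card_insert_of_notMem ha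
    have fin : ∀ U' : Submodule ℂ E, U' ≤ U → Module.finrank ℂ U ≤ 2 * Module.finrank ℂ U' →
        Module.finrank ℂ E ≤ 2 ^ (insert a s).card * Module.finrank ℂ U' := by
      intro U' _ h
      calc Module.finrank ℂ E ≤ 2 ^ s.card * Module.finrank ℂ U := hU
        _ ≤ 2 ^ s.card * (2 * Module.finrank ℂ U') := Nat.mul_le_mul_left _ h
        _ = _ := by rw [hcard, pow_succ, mul_assoc]
    rcases le_total (Module.finrank ℂ Um) (Module.finrank ℂ Up) with h | h
    · refine ⟨Up, fin Up inf_le_left (by omega), ?_, ?_⟩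
      -- Invariance is kept for all operators, also those not yet treated, so that the next
      -- splitting stays inside the subspace. It survives because `A j` commutes with `A a`.
      · intro j v hv
        rw [mp] at hv ⊢
        exact ⟨hinv j v hv.1, by rw [hc, hv.2]⟩
      · intro j hj
        rcases Finset.mem_insert.mp hj with rfl | hj
        · exact Or.inl fun v hv => ((mp v).mp hv).2
        · exact (hs j hj).imp (fun h v hv => h v ((mp v).mp hv).1)
            (fun h v hv => h v ((mp v).mp hv).1)
    · refine ⟨Um, fin Um inf_le_left (by omega), ?_, ?_⟩
      · intro j v hv
        rw [mm] at hv ⊢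
        exact ⟨hinv j v hv.1, by rw [hc, hv.2, map_neg]⟩
      · intro j hj
        rcases Finset.mem_insert.mp hj with rfl | hj
        · exact Or.inr fun v hv => ((mm v).mp hv).2
        · exact (hs j hj).imp (fun h v hv => h v ((mm v).mp hv).1)
            (fun h v hv => h v ((mm v).mp hv).1)

/-- Commuting Paulis have a joint eigenspace of at least the expected dimension. -/
lemma exists_isometry_into_eigenspace {ι κ Y : Type} [Fintype ι] [DecidableEq ι] [Fintype κ]
    [Fintype Y] [DecidableEq Y] (h : κ → Pauli ι) (hcomm : ∀ i j, symp (h i) (h j) = 0)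
    (hcard : Fintype.card Y * 2 ^ Fintype.card κ ≤ 2 ^ Fintype.card ι) :
    ∃ W : Matrix (Bits ι) Y ℂ, Wᴴ * W = 1 ∧
      ∀ j, pauliOp (h j) * W = W ∨ pauliOp (h j) * W = -W := by
  have lin : ∀ (M M' : Matrix (Bits ι) (Bits ι) ℂ) (v : EuclideanSpace ℂ (Bits ι)),
      Matrix.toEuclideanLin M (Matrix.toEuclideanLin M' v)
        = Matrix.toEuclideanLin (M * M') v := by
    intro M M' v
    simp [Matrix.toLpLin_apply, Matrix.mulVec_mulVec]
  obtain ⟨U, hU, -, hs⟩ := exists_common_eigenspace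
    (E := EuclideanSpace ℂ (Bits ι)) (fun j => Matrix.toEuclideanLin (pauliOp (h j)))
    (by intro j v; rw [lin, pauliOp_mul_self]; simp)
    (by intro i j v; rw [lin, lin, pauliOp_commute (hcomm i j)]) Finset.univ
  have hY : Fintype.card Y ≤ Module.finrank ℂ U := by
    have h1 : Module.finrank ℂ (EuclideanSpace ℂ (Bits ι)) = 2 ^ Fintype.card ι := by
      rw [finrank_euclideanSpace, Fintype.card_fun, Fintype.card_fin]
    rw [h1, Finset.card_univ] at hU
    have := hcard.trans hU
    rw [mul_comm] at this
    exact Nat.le_of_mul_le_mul_left this (by positivity)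
  -- Any `card Y` vectors of an orthonormal basis of the eigenspace can serve as the columns of `W`.
  let b := stdOrthonormalBasis ℂ U
  let f : Y → Fin (Module.finrank ℂ U) := fun y => Fin.castLE hY (Fintype.equivFin Y y)
  have hf : Function.Injective f := by
    intro x y hxy
    exact (Fintype.equivFin Y).injective (Fin.castLE_injective hY hxy)
  refine ⟨Matrix.of fun u y => (b (f y) : EuclideanSpace ℂ (Bits ι)) u, ?_, ?_⟩
  · ext x y
    have h1 := (orthonormal_iff_ite.mp b.orthonormal) (f x) (f y)
    rw [Submodule.coe_inner, PiLp.inner_apply] at h1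
    simp only [RCLike.inner_apply] at h1
    rw [Matrix.mul_apply, Matrix.one_apply]
    simp only [hf.eq_iff] at h1
    rw [← h1]
    refine Finset.sum_congr rfl fun u _ => ?_
    simp [Matrix.conjTranspose_apply, mul_comm]
  · intro j
    refine (hs j (Finset.mem_univ j)).imp ?_ ?_
    · intro hj
      ext u y
      exact congrFun (congrArg WithLp.ofLp (hj _ (b (f y)).2)) u
    · intro hj
      ext u y
      exact congrFun (congrArg WithLp.ofLp (hj _ (b (f y)).2)) u

lemma StabilizerCode.exists_isEncoder {ι : Type} [Fintype ι] [DecidableEq ι] {q m : ℕ}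
    (D : StabilizerCode ι q) (h : q + m = Fintype.card ι) :
    ∃ W : Matrix (Bits ι) (Bits (Fin m)) ℂ, D.IsEncoder W := by
  refine exists_isometry_into_eigenspace D.gen D.gen_comm ?_
  simp [← h, pow_add, mul_comm]

/-- The value of a bit as an element of the field with two elements. -/
def bitVal (a : Fin 2) : ZMod 2 := a

lemma bitVal_zero : bitVal 0 = 0 := rfl

lemma bitVal_one : bitVal 1 = 1 := rfl

lemma bitVal_add (a b : Fin 2) : bitVal (a + b) = bitVal a + bitVal b := rfl

lemma bitVal_injective : Function.Injective bitVal := fun _ _ h => h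

lemma pauliMat_X_apply (a b : Fin 2) :
    pauliMat ((1, 0) : Label) a b = if a = b + 1 then 1 else 0 := by
  fin_cases a <;> fin_cases b <;> simp [pauliMat]

lemma pauliMat_Z_apply (a b : Fin 2) :
    pauliMat ((0, 1) : Label) a b = if a = b then sgn (bitVal b) else 0 := by
  fin_cases a <;> fin_cases b <;> simp [pauliMat, sgn_zero, sgn_one, bitVal_zero, bitVal_one]

section BitFlips
variable {κ : Type} [Fintype κ] [DecidableEq κ]

lemma pauliOp_X_apply (j : κ) (u v : Bits κ) :
    pauliOp (Pi.single j ((1, 0) : Label)) u v = if u = v + Pi.single j 1 then 1 else 0 := by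
  have h : ∀ i, pauliMat ((Pi.single j ((1, 0) : Label) : Pauli κ) i) (u i) (v i)
      = if u i = (v + Pi.single j 1 : Bits κ) i then 1 else 0 := by
    intro i
    by_cases hi : i = j
    · subst hi; simp [pauliMat_X_apply]
    · simp [Pi.single_eq_of_ne hi, pauliMat_zero, Matrix.one_apply]
  rw [pauliOp, Matrix.of_apply]
  simp only [h, Finset.prod_ite_zero, Finset.prod_const_one, Finset.mem_univ, true_implies,
    funext_iff]

lemma pauliOp_Z_apply (j : κ) (u v : Bits κ) :
    pauliOp (Pi.single j ((0, 1) : Label)) u v = if u = v then sgn (bitVal (v j)) else 0 := by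
  have h : ∀ i, pauliMat ((Pi.single j ((0, 1) : Label) : Pauli κ) i) (u i) (v i)
      = if u i = v i then (if i = j then sgn (bitVal (v j)) else 1) else 0 := by
    intro i
    by_cases hi : i = j
    · subst hi; simp [pauliMat_Z_apply]
    · simp [pauliMat_zero, Matrix.one_apply, hi]
  rw [pauliOp, Matrix.of_apply]
  simp only [h, Finset.prod_ite_zero, Finset.mem_univ, true_implies, funext_iff]
  simp

end BitFlips

/-- Products of commuting Paulis as a family of operators indexed by bit strings. -/
lemma exists_flip_operators {ι κ : Type} [Fintype ι] [DecidableEq ι] [Fintype κ] [DecidableEq κ]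
    (g : κ → Pauli ι) (hg : ∀ i j, symp (g i) (g j) = 0) :
    ∃ Φ : Bits κ → Matrix (Bits ι) (Bits ι) ℂ,
      (∀ j x, Φ (x + Pi.single j 1) = pauliOp (g j) * Φ x) ∧
      ∀ x, PhaseEq (Φ x) (pauliOp (∑ j, (bitVal (x j)) • g j)) := by
  -- Each involution `pauliOp (g j)` is a representation of `ZMod 2`. As these commute, they combine
  -- into one homomorphism on bit strings, so that the flip relation holds exactly and not merely up
  -- to phase.
  let ϕ : κ → Multiplicative (ZMod 2) →* Matrix (Bits ι) (Bits ι) ℂ := fun j =>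
    { toFun := fun a => if a.toAdd = 0 then 1 else pauliOp (g j)
      map_one' := if_pos rfl
      map_mul' := by
        intro a b
        rw [toAdd_mul]
        rcases zmod_two_cases a.toAdd with h | h <;> rcases zmod_two_cases b.toAdd with h' | h' <;>
          simp [h, h', pauliOp_mul_self, CharTwo.add_self_eq_zero] }
  have hϕ : ∀ j a, ϕ j a = if a.toAdd = 0 then 1 else pauliOp (g j) := fun _ _ => rfl
  have hcomm : Pairwise fun i j => ∀ x y, Commute (ϕ i x) (ϕ j y) := by
    intro i j _ x y
    rw [hϕ, hϕ]
    split_ifs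
    · exact Commute.one_left _
    · exact Commute.one_left _
    · exact Commute.one_right _
    · exact pauliOp_commute (hg i j)
  let Ψ := MonoidHom.noncommPiCoprod ϕ hcomm
  let Φ : Bits κ → Matrix (Bits ι) (Bits ι) ℂ := fun x =>
    Ψ fun j => Multiplicative.ofAdd (bitVal (x j))
  have hadd : ∀ x y, Φ (x + y) = Φ x * Φ y := fun x y => map_mul Ψ _ _
  have hsingle : ∀ j a, Φ (Pi.single j a) = if bitVal a = 0 then 1 else pauliOp (g j) := by
    intro j a
    have h1 : (fun i => Multiplicative.ofAdd (bitVal ((Pi.single j a : Bits κ) i)))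
        = Pi.mulSingle j (Multiplicative.ofAdd (bitVal a)) := by
      funext i
      by_cases hi : i = j
      · subst hi; simp
      · simp [hi, bitVal_zero]
    change Ψ _ = _
    rw [h1, MonoidHom.noncommPiCoprod_mulSingle]
    rfl
  refine ⟨Φ, ?_, ?_⟩
  · intro j x
    rw [add_comm, hadd, hsingle, bitVal_one, if_neg one_ne_zero]
  -- The strings with the desired phase relation are closed under addition, so strings supported on
  -- one bit suffice.
  · let S : AddSubmonoid (Bits κ) :=
      { carrier := {x | PhaseEq (Φ x) (pauliOp (∑ j, bitVal (x j) • g j))}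
        zero_mem' := by
          have : Φ 0 = 1 := map_one Ψ
          simp only [Set.mem_ofPred_eq, this, Pi.zero_apply, bitVal_zero, zero_smul,
            Finset.sum_const_zero, pauliOp_zero]
          exact PhaseEq.refl _
        add_mem' := by
          intro x y hx hy
          simp only [Set.mem_ofPred_eq, hadd, Pi.add_apply, bitVal_add, add_smul,
            Finset.sum_add_distrib]
          exact (PhaseEq.mul hx hy).trans (pauliOp_mul _ _) }
    intro x
    change x ∈ S
    rw [← Finset.univ_sum_single x]
    refine S.sum_mem fun j _ => ?_
    change PhaseEq _ _
    rw [hsingle]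
    have h2 : ∑ i, bitVal ((Pi.single j (x j) : Bits κ) i) • g i = (bitVal (x j)) • g j := by
      rw [Finset.sum_eq_single j]
      · rw [Pi.single_eq_same]
      · intro i _ hi; rw [Pi.single_eq_of_ne hi, bitVal_zero, zero_smul]
      · simp
    rw [h2]
    rcases zmod_two_cases (bitVal (x j)) with h | h
    · rw [h, if_pos rfl, zero_smul, pauliOp_zero]; exact PhaseEq.refl _
    · rw [h, if_neg one_ne_zero, one_smul]; exact PhaseEq.refl _

/-- Commutation up to sign does not see global phases. -/
lemma PhaseEq.mul_comm_of_symp {ι : Type} [Fintype ι] [DecidableEq ι]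
    {A : Matrix (Bits ι) (Bits ι) ℂ} {e : Pauli ι} (h : PhaseEq A (pauliOp e)) (f : Pauli ι) :
    pauliOp f * A = sgn (symp f e) • (A * pauliOp f) := by
  obtain ⟨φ, -, rfl⟩ := h
  rw [Matrix.mul_smul, pauliOp_mul_comm, Matrix.smul_mul, smul_comm]

/-- The `r + k = n` commuting Paulis `C.gen` and `T.logZ` have a joint unit eigenvector `V₀`, the
encoded zero state; column `x` of `V` is `V₀` flipped by the logical `X` operators selected by `x`.
Columns that differ in bit `j` have opposite eigenvalues under `T.logZ j`, hence are orthogonal.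
Logical `X` acts without sign by construction; generators and logical `Z` inherit their signs from
`V₀`. -/
theorem Tableau.exists_isEncoder {n r k : ℕ} {C : StabilizerCode (Fin n) r} (T : Tableau C k)
    (hr : r + k = n) : ∃ V, T.IsEncoder V := by
  obtain ⟨V₀, hV₀, hh⟩ := exists_isometry_into_eigenspace (Y := Unit)
    (Sum.elim C.gen T.logZ) (by
      rintro (i | i) (j | j)
      · exact C.gen_comm i j
      · exact T.gen_logZ i j
      · exact (symp_comm _ _).trans (T.gen_logZ j i)
      · exact T.logZ_logZ i j) (by simp [hr])
  have hgen : ∀ i, pauliOp (C.gen i) * V₀ = V₀ ∨ pauliOp (C.gen i) * V₀ = -V₀ :=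
    fun i => hh (Sum.inl i)
  have hlog : ∀ i, pauliOp (T.logZ i) * V₀ = V₀ ∨ pauliOp (T.logZ i) * V₀ = -V₀ :=
    fun i => hh (Sum.inr i)
  obtain ⟨Φ, hΦ, hΦp⟩ := exists_flip_operators T.logX T.logX_logX
  let V : Matrix (Bits (Fin n)) (Bits (Fin k)) ℂ := Matrix.of fun u x => (Φ x * V₀) u ()
  have hmul : ∀ (M : Matrix (Bits (Fin n)) (Bits (Fin n)) ℂ) u x,
      (M * V) u x = (M * Φ x * V₀) u () := by
    intro M u x; rw [Matrix.mul_assoc]; rfl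
  have hVX : ∀ (u : Bits (Fin n)) (x : Bits (Fin k)) (j : Fin k),
      (V * pauliOp (Pi.single j ((1, 0) : Label))) u x
        = V u (x + Pi.single j 1) := by
    intro u x j
    simp [Matrix.mul_apply, pauliOp_X_apply]
  have hVZ : ∀ (u : Bits (Fin n)) (x : Bits (Fin k)) (j : Fin k),
      (V * pauliOp (Pi.single j ((0, 1) : Label))) u x
      = V u x * sgn (bitVal (x j)) := by
    intro u x j
    simp [Matrix.mul_apply, pauliOp_Z_apply]
  have sympX : ∀ (f : Pauli (Fin n)) (x : Bits (Fin k)),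
      symp f (∑ j, (bitVal (x j)) • T.logX j) = ∑ j, bitVal (x j) * symp f (T.logX j) := by
    intro f x
    simp only [symp_sum_right, symp_smul_right]
  have sympZ : ∀ (i : Fin k) (x : Bits (Fin k)),
      symp (T.logZ i) (∑ j, (bitVal (x j)) • T.logX j) = bitVal (x i) := by
    intro i x
    rw [sympX]
    simp [symp_comm (T.logZ i), T.logX_logZ]
  refine ⟨V, ⟨?_, ?_⟩, ?_, ?_⟩
  · ext x y
    have h1 : (Vᴴ * V) x y = (V₀ᴴ * ((Φ x)ᴴ * Φ y) * V₀) () () := by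
      have : V₀ᴴ * ((Φ x)ᴴ * Φ y) * V₀ = (Φ x * V₀)ᴴ * (Φ y * V₀) := by
        simp only [Matrix.conjTranspose_mul, Matrix.mul_assoc]
      rw [this]; rfl
    rw [h1]
    by_cases hxy : x = y
    · subst hxy
      obtain ⟨φ, hφ, h2⟩ := hΦp x
      have h3 : star φ * φ = 1 := by
        rw [Complex.star_def, Complex.conj_mul', hφ]; simp
      have h4 : (Φ x)ᴴ * Φ x = 1 := by
        rw [h2, Matrix.conjTranspose_smul, Matrix.smul_mul, Matrix.mul_smul, smul_smul, h3,
          pauliOp_conjTranspose, pauliOp_mul_self, one_smul]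
      rw [h4, Matrix.mul_one, hV₀]
      simp
    · obtain ⟨j, hj⟩ := Function.ne_iff.mp hxy
      have h2 : PhaseEq ((Φ x)ᴴ * Φ y)
          (pauliOp (∑ j, (bitVal (x j)) • T.logX j + ∑ j, (bitVal (y j)) • T.logX j)) := by
        have := (hΦp x).conjTranspose.mul (hΦp y)
        rw [pauliOp_conjTranspose] at this
        exact this.trans (pauliOp_mul _ _)
      have h3 : V₀ᴴ * ((Φ x)ᴴ * Φ y) * V₀ = 0 := by
        refine (((PhaseEq.refl V₀ᴴ).mul h2).mul (PhaseEq.refl V₀)).eq_zero ?_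
        refine conjTranspose_pauliOp_mul_eq_zero (hlog j) ?_
        rw [symp_comm, symp_add_right, sympZ, sympZ]
        intro h0
        exact hj (bitVal_injective (CharTwo.add_eq_zero.mp h0))
      rw [h3, Matrix.one_apply_ne hxy]; rfl
  · intro i
    have h1 : ∀ x, pauliOp (C.gen i) * Φ x * V₀ = Φ x * (pauliOp (C.gen i) * V₀) := by
      intro x
      rw [(hΦp x).mul_comm_of_symp, sympX]
      simp [T.gen_logX, sgn_zero, Matrix.mul_assoc]
    refine (hgen i).imp ?_ ?_ <;> intro h <;> ext u x <;> rw [hmul, h1, h]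
    · rfl
    · rw [Matrix.mul_neg]; rfl
  · intro j
    left
    ext u x
    rw [hmul, hVX, ← hΦ]; rfl
  · intro j
    have h1 : ∀ x, pauliOp (T.logZ j) * Φ x * V₀
        = sgn (bitVal (x j)) • (Φ x * (pauliOp (T.logZ j) * V₀)) := by
      intro x
      rw [(hΦp x).mul_comm_of_symp, sympZ, Matrix.smul_mul, Matrix.mul_assoc]
    refine (hlog j).imp ?_ ?_ <;> intro h <;> ext u x
    · rw [hmul, h1, h, hVZ]
      exact mul_comm _ _
    · rw [hmul, h1, h, Matrix.neg_apply, hVZ, Matrix.mul_neg, smul_neg, Matrix.neg_apply]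
      exact congrArg _ (mul_comm _ _)

/-! ## Tableau coordinates of physical Paulis -/

namespace Tableau
variable {n r k : ℕ} {C : StabilizerCode (Fin n) r}

lemma symp_assemble (T : Tableau C k) (t : Fin r → ZMod 2) (l : Pauli (Fin k))
    (s : Fin r → ZMod 2) (f : Pauli (Fin n)) :
    symp (T.assemble t l s) f = ∑ i, t i * symp (C.gen i) f + ∑ j, (l j).1 * symp (T.logX j) f
      + ∑ j, (l j).2 * symp (T.logZ j) f + ∑ i, s i * symp (T.pure i) f := by
  simp only [assemble, symp_add_left, symp_sum_left, symp_smul_left]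

lemma symp_pure_gen (T : Tableau C k) (s : Fin r → ZMod 2) (i : Fin r) :
    symp (∑ i, s i • T.pure i) (C.gen i) = s i := by
  simp only [symp_sum_left, symp_smul_left, symp_comm (T.pure _), T.gen_pure]
  simp

/-- `assemble` as a linear map. -/
def assembleLin (T : Tableau C k) :
    (Fin r → ZMod 2) × Pauli (Fin k) × (Fin r → ZMod 2) →ₗ[ZMod 2] Pauli (Fin n) where
  toFun a := T.assemble a.1 a.2.1 a.2.2
  map_add' := by
    intro a b
    simp only [assemble, Prod.fst_add, Prod.snd_add, Pi.add_apply, add_smul,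
      Finset.sum_add_distrib]
    abel
  map_smul' := by
    intro c a
    simp only [assemble, Prod.smul_fst, Prod.smul_snd, Pi.smul_apply, smul_add, Finset.smul_sum,
      smul_smul, smul_eq_mul, RingHom.id_apply]

/-- The coordinates are read off by symplectic pairing: `C.gen` detects `s`, the logical operators
then detect `l`, and `T.pure` finally detects `t`. The order matters, because pairings among pure
errors, or of these with logical Paulis, are arbitrary. -/
lemma assembleLin_injective (T : Tableau C k) : Function.Injective T.assembleLin := by
  rw [← LinearMap.ker_eq_bot, LinearMap.ker_eq_bot']
  rintro ⟨t, l, s⟩ h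
  replace h : T.assemble t l s = 0 := h
  have h0 : ∀ f, symp (T.assemble t l s) f = 0 := by
    intro f; rw [h, symp_zero_left]
  have hs : s = 0 := by
    funext i
    have := h0 (C.gen i)
    rw [symp_assemble] at this
    simpa [C.gen_comm, symp_comm (T.logX _), symp_comm (T.logZ _), T.gen_logX, T.gen_logZ,
      symp_comm (T.pure _), T.gen_pure] using this
  subst hs
  have hx : ∀ j, (l j).1 = 0 := by
    intro j
    have := h0 (T.logZ j)
    rw [symp_assemble] at this
    simpa [T.gen_logZ, T.logX_logZ, T.logZ_logZ] using this
  have hz : ∀ j, (l j).2 = 0 := by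
    intro j
    have := h0 (T.logX j)
    rw [symp_assemble] at this
    simpa [T.gen_logX, T.logX_logX, symp_comm (T.logZ _), T.logX_logZ] using this
  have hl : l = 0 := by
    funext j
    exact Prod.ext (hx j) (hz j)
  subst hl
  have ht : t = 0 := by
    funext i
    have := h0 (T.pure i)
    rw [symp_assemble] at this
    simpa [T.gen_pure] using this
  rw [ht]; rfl

/-- Both sides have `2 ^ r * 4 ^ k * 2 ^ r = 4 ^ n` elements. -/
lemma assembleLin_bijective (T : Tableau C k) (hr : r + k = n) :
    Function.Bijective T.assembleLin := by
  rw [Fintype.bijective_iff_injective_and_card]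
  refine ⟨T.assembleLin_injective, ?_⟩
  simp only [Fintype.card_prod, Fintype.card_fun, ZMod.card, Fintype.card_fin, ← hr]
  rw [pow_add, show (2 * 2 : ℕ) = 2 ^ 2 by norm_num, ← pow_mul, ← pow_mul]
  ring

/-- The physical Pauli on `N` blocks with the given tableau coordinates in each block. -/
def blockAssemble (T : Tableau C k) {N : ℕ}
    (a : (Fin N → Fin r → ZMod 2) × Pauli (Fin N × Fin k) × (Fin N → Fin r → ZMod 2)) :
    Pauli (Fin N × Fin n) :=
  fun q => T.assemble (a.1 q.1) (fun j => a.2.1 (q.1, j)) (a.2.2 q.1) q.2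

lemma blockAssemble_injective (T : Tableau C k) (N : ℕ) :
    Function.Injective (T.blockAssemble (N := N)) := by
  rintro ⟨t, l, s⟩ ⟨t', l', s'⟩ h
  have hb : ∀ b, (t b, (fun j => l (b, j)), s b) = (t' b, (fun j => l' (b, j)), s' b) := by
    intro b
    apply T.assembleLin_injective
    funext i
    exact congrFun h (b, i)
  have h1 : t = t' := funext fun b => congrArg Prod.fst (hb b)
  have h2 : l = l' := by
    funext ⟨b, j⟩
    exact congrFun (congrArg (fun x => x.2.1) (hb b)) j
  have h3 : s = s' := funext fun b => congrArg (fun x => x.2.2) (hb b)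
  rw [h1, h2, h3]

/-- The joint pmf of the logical Pauli errors and the syndromes of `N` blocks. -/
def blockJoint (T : Tableau C k) (p : Label → ℝ) {N : ℕ} (l : Pauli (Fin N × Fin k))
    (s : Fin N → Fin r → ZMod 2) : ℝ :=
  ∏ b, T.joint p (fun j => l (b, j)) (s b)

/-- The stabilizer parts do not affect encoded states, so only this sum over them enters. A product
over blocks of sums over `t` expands into a sum over all choices of `t`. -/
lemma sum_prod_blockAssemble (T : Tableau C k) (p : Label → ℝ) {N : ℕ}
    (l : Pauli (Fin N × Fin k)) (s : Fin N → Fin r → ZMod 2) :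
    ∑ t, ∏ q, p (T.blockAssemble (t, l, s) q) = T.blockJoint p l s := by
  simp only [blockJoint, joint, Finset.prod_univ_sum, Fintype.piFinset_univ]
  exact Finset.sum_congr rfl fun t _ => Fintype.prod_prod_type _

lemma sum_joint (T : Tableau C k) (hr : r + k = n) {p : Label → ℝ} (hp : ∑ a, p a = 1) :
    ∑ l, ∑ s, T.joint p l s = 1 := by
  have h1 : ∑ e : Pauli (Fin n), ∏ i, p (e i) = 1 := by
    rw [← Fintype.piFinset_univ, ← Finset.prod_univ_sum]
    simp [hp]
  rw [← (T.assembleLin_bijective hr).sum_comp, Fintype.sum_prod_type, Finset.sum_comm,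
    Fintype.sum_prod_type] at h1
  exact h1

lemma joint_nonneg (T : Tableau C k) {p : Label → ℝ} (hp : ∀ a, 0 ≤ p a) (l : Pauli (Fin k))
    (s : Fin r → ZMod 2) : 0 ≤ T.joint p l s :=
  Finset.sum_nonneg fun _ _ => Finset.prod_nonneg fun _ _ => hp _

/-- Up to phase, a physical Pauli acts on encoded states as its pure error after its logical
part. -/
lemma pauliOp_assemble_mul (T : Tableau C k) {V : Matrix (Bits (Fin n)) (Bits (Fin k)) ℂ}
    (hV : T.IsEncoder V) (t : Fin r → ZMod 2) (l : Pauli (Fin k)) (s : Fin r → ZMod 2) :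
    PhaseEq (pauliOp (T.assemble t l s) * V)
      (pauliOp (∑ i, s i • T.pure i) * V * pauliOp l) := by
  -- Since `implements V` is a subspace, only the stabilizer generators and the logical generators
  -- need to be checked.
  have hmem : (∑ i, t i • C.gen i + ∑ j, (l j).1 • T.logX j + ∑ j, (l j).2 • T.logZ j, l)
      ∈ implements V := by
    have e : ((∑ i, t i • C.gen i + ∑ j, (l j).1 • T.logX j + ∑ j, (l j).2 • T.logZ j, l) :
          Pauli (Fin n) × Pauli (Fin k))
        = ∑ i, t i • (C.gen i, (0 : Pauli (Fin k)))
          + ∑ j, (l j).1 • (T.logX j, (Pi.single j ((1, 0) : Label) : Pauli (Fin k)))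
          + ∑ j, (l j).2 • (T.logZ j, (Pi.single j ((0, 1) : Label) : Pauli (Fin k))) := by
      refine Prod.ext ?_ ?_
      · simp [Prod.fst_sum]
      · simp only [Prod.snd_add, Prod.snd_sum, Prod.smul_snd, smul_zero, Finset.sum_const_zero,
          zero_add, ← Finset.sum_add_distrib]
        conv_lhs => rw [← Finset.univ_sum_single l]
        refine Finset.sum_congr rfl fun j _ => ?_
        rw [← Pi.single_smul, ← Pi.single_smul, ← Pi.single_add]
        congr 1
        ext <;> simp
    rw [e]
    refine add_mem (add_mem ?_ ?_) ?_
    · refine sum_mem fun i _ => Submodule.smul_mem _ _ ?_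
      rw [mem_implements, pauliOp_zero, Matrix.mul_one]
      exact PhaseEq.of_sign (hV.1.2 i)
    · exact sum_mem fun j _ => Submodule.smul_mem _ _ (PhaseEq.of_sign (hV.2.1 j))
    · exact sum_mem fun j _ => Submodule.smul_mem _ _ (PhaseEq.of_sign (hV.2.2 j))
  have h1 := ((pauliOp_mul (∑ i, s i • T.pure i)
    (∑ i, t i • C.gen i + ∑ j, (l j).1 • T.logX j + ∑ j, (l j).2 • T.logZ j)).symm).mul
    (PhaseEq.refl V)
  rw [add_comm (∑ i, s i • T.pure i), Matrix.mul_assoc] at h1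
  refine h1.trans ?_
  rw [Matrix.mul_assoc]
  exact (PhaseEq.refl _).mul hmem

/-- The product of two pure errors with different syndromes anticommutes with some generator. -/
lemma pure_translates_orthogonal (T : Tableau C k) {V : Matrix (Bits (Fin n)) (Bits (Fin k)) ℂ}
    (hV : C.IsEncoder V) {s s' : Fin r → ZMod 2} (h : s ≠ s') :
    Vᴴ * pauliOp (∑ i, s i • T.pure i) * (pauliOp (∑ i, s' i • T.pure i) * V) = 0 := by
  obtain ⟨i, hi⟩ := Function.ne_iff.mp h
  rw [Matrix.mul_assoc, ← Matrix.mul_assoc (pauliOp _) (pauliOp _), ← Matrix.mul_assoc]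
  refine (((PhaseEq.refl Vᴴ).mul (pauliOp_mul _ _)).mul (PhaseEq.refl V)).eq_zero ?_
  refine conjTranspose_pauliOp_mul_eq_zero (hV.2 i) ?_
  rw [symp_add_left, symp_pure_gen, symp_pure_gen]
  exact fun h0 => hi (CharTwo.add_eq_zero.mp h0)

end Tableau

/-! ## Tensor products over blocks -/

section Blocks
variable {N : ℕ} {α β γ : Type}

/-- The tensor product of operators on blocks of qubits. -/
def blockTens (M : Fin N → Matrix (Bits α) (Bits β) ℂ) :
    Matrix (Bits (Fin N × α)) (Bits (Fin N × β)) ℂ :=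
  (tens M).submatrix (Equiv.curry _ _ _) (Equiv.curry _ _ _)

lemma blockTens_mul [Fintype β] [DecidableEq β] (M : Fin N → Matrix (Bits α) (Bits β) ℂ)
    (M' : Fin N → Matrix (Bits β) (Bits γ) ℂ) :
    blockTens M * blockTens M' = blockTens fun b => M b * M' b := by
  rw [blockTens, blockTens, Matrix.submatrix_mul_equiv, tens_mul]; rfl

lemma blockTens_conjTranspose (M : Fin N → Matrix (Bits α) (Bits β) ℂ) :
    (blockTens M)ᴴ = blockTens fun b => (M b)ᴴ := by
  rw [blockTens, Matrix.conjTranspose_submatrix, tens_conjTranspose]; rfl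

lemma blockTens_one [Fintype α] [DecidableEq α] :
    blockTens (fun _ : Fin N => (1 : Matrix (Bits α) (Bits α) ℂ)) = 1 := by
  rw [blockTens, tens_one, Matrix.submatrix_one_equiv]

lemma PhaseEq.blockTens {A B : Fin N → Matrix (Bits α) (Bits β) ℂ}
    (h : ∀ b, PhaseEq (A b) (B b)) : PhaseEq (blockTens A) (blockTens B) :=
  (PhaseEq.tens h).submatrix _ _

lemma blockTens_eq_zero {M : Fin N → Matrix (Bits α) (Bits β) ℂ} {b : Fin N} (h : M b = 0) :
    blockTens M = 0 := by
  rw [PauliHashing.blockTens, tens_eq_zero h]; rfl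

lemma blockPow_eq {n k : ℕ} (V : Matrix (Bits (Fin n)) (Bits (Fin k)) ℂ) :
    blockPow N V = blockTens fun _ => V := rfl

lemma pauliOp_eq_blockTens [Fintype α] (e : Pauli (Fin N × α)) :
    pauliOp e = blockTens fun b => pauliOp fun i => e (b, i) := by
  ext u v
  exact Fintype.prod_prod_type _

variable {n r k : ℕ} {C : StabilizerCode (Fin n) r}

lemma blockPow_isometry {V : Matrix (Bits (Fin n)) (Bits (Fin k)) ℂ} (hV : Vᴴ * V = 1) :
    (blockPow N V)ᴴ * blockPow N V = 1 := by
  rw [blockPow_eq, blockTens_conjTranspose, blockTens_mul]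
  simp only [hV, blockTens_one]

lemma pauliOp_blockAssemble (T : Tableau C k) (t : Fin N → Fin r → ZMod 2)
    (l : Pauli (Fin N × Fin k)) (s : Fin N → Fin r → ZMod 2) :
    pauliOp (T.blockAssemble (t, l, s))
      = blockTens fun b => pauliOp (T.assemble (t b) (fun j => l (b, j)) (s b)) :=
  pauliOp_eq_blockTens _

lemma pauliOp_blockPure (T : Tableau C k) (s : Fin N → Fin r → ZMod 2) :
    pauliOp (blockPure T s) = blockTens fun b => pauliOp (∑ i, s b i • T.pure i) :=
  pauliOp_eq_blockTens _

lemma pauliOp_blockAssemble_mul (T : Tableau C k) {V : Matrix (Bits (Fin n)) (Bits (Fin k)) ℂ}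
    (hV : T.IsEncoder V) (t : Fin N → Fin r → ZMod 2) (l : Pauli (Fin N × Fin k))
    (s : Fin N → Fin r → ZMod 2) :
    PhaseEq (pauliOp (T.blockAssemble (t, l, s)) * blockPow N V)
      (pauliOp (blockPure T s) * blockPow N V * pauliOp l) := by
  rw [pauliOp_blockAssemble, pauliOp_blockPure, pauliOp_eq_blockTens l, blockPow_eq,
    blockTens_mul, blockTens_mul, blockTens_mul]
  exact PhaseEq.blockTens fun b => T.pauliOp_assemble_mul hV (t b) (fun j => l (b, j)) (s b)

lemma blockPure_translates_orthogonal (T : Tableau C k)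
    {V : Matrix (Bits (Fin n)) (Bits (Fin k)) ℂ}
    (hV : C.IsEncoder V) {s s' : Fin N → Fin r → ZMod 2} (h : s ≠ s') :
    (blockPow N V)ᴴ * pauliOp (blockPure T s) * (pauliOp (blockPure T s') * blockPow N V) = 0 := by
  obtain ⟨b, hb⟩ := Function.ne_iff.mp h
  rw [pauliOp_blockPure, pauliOp_blockPure, blockPow_eq, blockTens_conjTranspose, blockTens_mul,
    blockTens_mul, blockTens_mul]
  exact blockTens_eq_zero (b := b) (T.pure_translates_orthogonal hV hb)

/-- The `2 ^ (r N)` pure error translates of the code space are orthogonal, each of dimension `2 ^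
(k N)`; together they fill the whole space of dimension `2 ^ (n N)`. -/
lemma innerDecoder_isChannel (T : Tableau C k) (hr : r + k = n)
    {V : Matrix (Bits (Fin n)) (Bits (Fin k)) ℂ} (hV : C.IsEncoder V) :
    ∑ s : Fin N → Fin r → ZMod 2, (innerDecoder T V s)ᴴ * innerDecoder T V s = 1 := by
  rw [← sum_pauliOp_translates_eq_one (blockPow_isometry hV.1) (blockPure T (N := N))
    (fun s s' h => blockPure_translates_orthogonal T hV h)]
  · refine Finset.sum_congr rfl fun s _ => ?_
    rw [innerDecoder, Matrix.conjTranspose_mul, pauliOp_conjTranspose,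
      Matrix.conjTranspose_conjTranspose]
  · simp only [Fintype.card_fun, Fintype.card_prod, ZMod.card, Fintype.card_fin, ← hr]
    rw [← pow_mul, ← pow_add]
    ring

end Blocks

/-! ## The decoder of the concatenated code -/

section Decoder
variable {N n r k q m : ℕ} {C : StabilizerCode (Fin n) r}

/-- The same dimension count for the outer code. Only the syndromes of the corrections matter, so
any rule consistent with the syndrome gives a trace-preserving decoder. -/
lemma sum_outer_corrections {ι : Type} [Fintype ι] [DecidableEq ι] {D : StabilizerCode ι q}
    {W : Matrix (Bits ι) (Bits (Fin m)) ℂ} (hW : D.IsEncoder W) (hq : q + m = Fintype.card ι)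
    (c : (Fin q → ZMod 2) → Pauli ι) (hc : ∀ σ, D.syndrome (c σ) = σ) :
    ∑ σ, pauliOp (c σ) * W * (Wᴴ * pauliOp (c σ)) = 1 := by
  refine sum_pauliOp_translates_eq_one hW.1 c ?_ ?_
  · intro σ σ' h
    obtain ⟨i, hi⟩ := Function.ne_iff.mp h
    rw [Matrix.mul_assoc, ← Matrix.mul_assoc (pauliOp _) (pauliOp _), ← Matrix.mul_assoc]
    refine (((PhaseEq.refl Wᴴ).mul (pauliOp_mul _ _)).mul (PhaseEq.refl W)).eq_zero ?_
    refine conjTranspose_pauliOp_mul_eq_zero (hW.2 i) ?_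
    rw [symp_add_left]
    intro h0
    refine hi ?_
    rw [← hc σ, ← hc σ']
    exact CharTwo.add_eq_zero.mp h0
  · simp [← hq, pow_add]

lemma concatDecoder_isChannel (T : Tableau C k) (hr : r + k = n)
    {V : Matrix (Bits (Fin n)) (Bits (Fin k)) ℂ} (hV : C.IsEncoder V)
    {D : StabilizerCode (Fin N × Fin k) q} {W : Matrix (Bits (Fin N × Fin k)) (Bits (Fin m)) ℂ}
    (hW : D.IsEncoder W) (hq : q + m = N * k)
    (c : (Fin N → Fin r → ZMod 2) → (Fin q → ZMod 2) → Pauli (Fin N × Fin k))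
    (hc : ∀ s σ, D.syndrome (c s σ) = σ) : IsChannel (concatDecoder T V W c) := by
  rw [IsChannel, Fintype.sum_prod_type, ← innerDecoder_isChannel T hr hV]
  refine Finset.sum_congr rfl fun s _ => ?_
  have h1 := sum_outer_corrections hW (by simpa using hq) (c s) (hc s)
  have h2 : ∀ σ, (concatDecoder T V W c (s, σ))ᴴ * concatDecoder T V W c (s, σ)
      = (innerDecoder T V s)ᴴ * (pauliOp (c s σ) * W * (Wᴴ * pauliOp (c s σ)))
        * innerDecoder T V s := by
    intro σ
    simp only [concatDecoder, Matrix.conjTranspose_mul, Matrix.conjTranspose_conjTranspose,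
      pauliOp_conjTranspose, Matrix.mul_assoc]
  simp only [h2]
  rw [← Matrix.sum_mul, ← Matrix.mul_sum, h1, Matrix.mul_one]

/-- The Paulis acting on the code space as a phase form a subspace, and it contains the generators.
-/
lemma StabilizerCode.IsEncoder.pauliOp_mul_of_mem_span {ι : Type} [Fintype ι] [DecidableEq ι]
    {D : StabilizerCode ι q} {W : Matrix (Bits ι) (Bits (Fin m)) ℂ} (hW : D.IsEncoder W)
    {e : Pauli ι} (he : e ∈ Submodule.span (ZMod 2) (Set.range D.gen)) :
    PhaseEq (pauliOp e * W) W := by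
  have h1 : Submodule.span (ZMod 2) (Set.range D.gen)
      ≤ (implements W).comap (LinearMap.inl (ZMod 2) (Pauli ι) (Pauli (Fin m))) := by
    rw [Submodule.span_le]
    rintro _ ⟨i, rfl⟩
    change PhaseEq _ (W * pauliOp (0 : Pauli (Fin m)))
    rw [pauliOp_zero, Matrix.mul_one]
    exact PhaseEq.of_sign (hW.2 i)
  have h2 : PhaseEq (pauliOp e * W) (W * pauliOp (0 : Pauli (Fin m))) := h1 he
  rwa [pauliOp_zero, Matrix.mul_one] at h2

/-- If the correction equals the logical error up to a stabilizer of the outer code, then the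
encoded state is recovered. -/
lemma concatDecoder_recovers (T : Tableau C k)
    {V : Matrix (Bits (Fin n)) (Bits (Fin k)) ℂ} (hV : T.IsEncoder V)
    {D : StabilizerCode (Fin N × Fin k) q} {W : Matrix (Bits (Fin N × Fin k)) (Bits (Fin m)) ℂ}
    (hW : D.IsEncoder W)
    (c : (Fin N → Fin r → ZMod 2) → (Fin q → ZMod 2) → Pauli (Fin N × Fin k))
    (t : Fin N → Fin r → ZMod 2) (l : Pauli (Fin N × Fin k)) (s : Fin N → Fin r → ZMod 2)
    (σ : Fin q → ZMod 2)
    (h : c s σ + l ∈ Submodule.span (ZMod 2) (Set.range D.gen)) :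
    PhaseEq (concatDecoder T V W c (s, σ)
      * (pauliOp (T.blockAssemble (t, l, s)) * concatEncoder V W)) 1 := by
  have h1 := ((PhaseEq.refl (Wᴴ * pauliOp (c s σ) * innerDecoder T V s)).mul
    (pauliOp_blockAssemble_mul T hV t l s)).mul (PhaseEq.refl W)
  -- The pure error squares to one and `V` is an isometry, so the inner decoder leaves just the
  -- logical error.
  have h2 : Wᴴ * pauliOp (c s σ) * innerDecoder T V s
        * (pauliOp (blockPure T s) * blockPow N V * pauliOp l) * W
      = Wᴴ * (pauliOp (c s σ) * pauliOp l * W) := by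
    calc _ = Wᴴ * pauliOp (c s σ) * ((blockPow N V)ᴴ * ((pauliOp (blockPure T s)
            * pauliOp (blockPure T s)) * blockPow N V)) * pauliOp l * W := by
          simp only [innerDecoder, Matrix.mul_assoc]
      _ = _ := by
          rw [pauliOp_mul_self, Matrix.one_mul, blockPow_isometry hV.1.1]
          simp only [Matrix.mul_one, Matrix.mul_assoc]
  rw [h2] at h1
  have h3 : concatDecoder T V W c (s, σ)
        * (pauliOp (T.blockAssemble (t, l, s)) * concatEncoder V W)
      = Wᴴ * pauliOp (c s σ) * innerDecoder T V s
        * (pauliOp (T.blockAssemble (t, l, s)) * blockPow N V) * W := by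
    simp only [concatDecoder, concatEncoder, Matrix.mul_assoc]
  rw [h3]
  refine h1.trans ?_
  have h4 : Wᴴ * W = 1 := hW.1
  rw [← h4]
  refine (PhaseEq.refl _).mul ?_
  exact ((pauliOp_mul _ _).mul (PhaseEq.refl W)).trans (hW.pauliOp_mul_of_mem_span h)

end Decoder

/-! ## Entanglement fidelity -/

lemma withReference_vecMulVec_entry {X I : Type} [Fintype X] [Fintype I] (d : ℕ) (w : I → ℝ)
    (A : I → Matrix X X ℂ) (ψ : Fin d × X → ℂ) (u v : Fin d × X) :
    withReference d (fun ρ => ∑ i, (w i : ℂ) • (A i * ρ * (A i)ᴴ))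
        (Matrix.vecMulVec ψ (star ψ)) u v
      = ∑ i, (w i : ℂ) * ((A i *ᵥ fun x => ψ (u.1, x)) u.2
          * star ((A i *ᵥ fun x => ψ (v.1, x)) v.2)) := by
  simp only [withReference, Matrix.of_apply, Matrix.sum_apply, Matrix.smul_apply, smul_eq_mul]
  refine Finset.sum_congr rfl fun i _ => ?_
  congr 1
  have h1 : (Matrix.of fun x y => Matrix.vecMulVec ψ (star ψ) (u.1, x) (v.1, y))
      = Matrix.vecMulVec (fun x => ψ (u.1, x)) (star fun x => ψ (v.1, x)) := rfl
  rw [h1, Matrix.mul_vecMulVec, Matrix.vecMulVec_mul, ← Matrix.star_mulVec]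
  rfl

/-- Each `A i` maps the pure state to a rank-one operator, whose expectation in `ψ` is a squared
overlap. Written so, the fidelity is a sum of nonnegative terms when the weights are nonnegative. -/
lemma fidelity_eq_sum {X I : Type} [Fintype X] [Fintype I] (d : ℕ) (w : I → ℝ)
    (A : I → Matrix X X ℂ) (ψ : Fin d × X → ℂ) :
    star ψ ⬝ᵥ (withReference d (fun ρ => ∑ i, (w i : ℂ) • (A i * ρ * (A i)ᴴ))
        (Matrix.vecMulVec ψ (star ψ)) *ᵥ ψ)
      = ∑ i, ((w i * ‖∑ u, star (ψ u) * (A i *ᵥ fun x => ψ (u.1, x)) u.2‖ ^ 2 : ℝ) : ℂ) := by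
  simp only [dotProduct, Matrix.mulVec, withReference_vecMulVec_entry, Pi.star_apply]
  have h : ∀ i, ((w i * ‖∑ u, star (ψ u) * (A i *ᵥ fun x => ψ (u.1, x)) u.2‖ ^ 2 : ℝ) : ℂ)
      = ∑ u, ∑ v, star (ψ u) * ((w i : ℂ) * ((A i *ᵥ fun x => ψ (u.1, x)) u.2
          * star ((A i *ᵥ fun x => ψ (v.1, x)) v.2)) * ψ v) := by
    intro i
    push_cast
    rw [← Complex.mul_conj', ← Complex.star_def, star_sum, Finset.sum_mul_sum, Finset.mul_sum]
    refine Finset.sum_congr rfl fun u _ => ?_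
    rw [Finset.mul_sum]
    refine Finset.sum_congr rfl fun v _ => ?_
    rw [star_mul, star_star]; ring
  simp only [dotProduct, Matrix.mulVec] at h
  simp only [h]
  rw [Finset.sum_comm]
  refine Finset.sum_congr rfl fun u _ => ?_
  rw [Finset.sum_comm, Finset.mul_sum]
  refine Finset.sum_congr rfl fun v _ => ?_
  rw [Finset.sum_mul, Finset.mul_sum]

/-- A phase times the identity has overlap of modulus one with every `ψ`, whatever the reference;
all other terms are dropped as nonnegative. -/
lemma fidelityAtLeast_of_phaseEq_one {X I : Type} [Fintype X] [DecidableEq X] [Fintype I]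
    {Φ : Matrix X X ℂ → Matrix X X ℂ} {w : I → ℝ} (hw : ∀ i, 0 ≤ w i) {A : I → Matrix X X ℂ}
    (hΦ : ∀ ρ, Φ ρ = ∑ i, (w i : ℂ) • (A i * ρ * (A i)ᴴ)) (s : Finset I)
    (hs : ∀ i ∈ s, PhaseEq (A i) 1) : FidelityAtLeast Φ (∑ i ∈ s, w i) := by
  intro d ψ hψ
  rw [funext hΦ, fidelity_eq_sum, ← Complex.ofReal_sum, Complex.ofReal_re]
  have h1 : ∀ i ∈ s, w i = w i * ‖∑ u, star (ψ u) * (A i *ᵥ fun x => ψ (u.1, x)) u.2‖ ^ 2 := by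
    intro i hi
    obtain ⟨φ, hφ, hA⟩ := hs i hi
    have h2 : ∑ u, star (ψ u) * (A i *ᵥ fun x => ψ (u.1, x)) u.2 = φ * ((1 : ℝ) : ℂ) := by
      rw [← hψ, Complex.ofReal_sum, Finset.mul_sum]
      refine Finset.sum_congr rfl fun u _ => ?_
      rw [hA, Matrix.smul_mulVec, Matrix.one_mulVec, Pi.smul_apply, smul_eq_mul, mul_left_comm]
      congr 1
      rw [Complex.star_def, Complex.conj_mul']; push_cast; rfl
    rw [h2]; simp [hφ]
  rw [Finset.sum_congr rfl h1]
  exact Finset.sum_le_sum_of_subset_of_nonneg (Finset.subset_univ _)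
    fun i _ _ => mul_nonneg (hw i) (sq_nonneg _)

lemma applyKraus_pauliChannel {ι A X Y : Type} [Fintype ι] [DecidableEq ι] [Fintype A] [Fintype X]
    [Fintype Y] (p : Label → ℝ) (K : A → Matrix Y (Bits ι) ℂ) (B : Matrix (Bits ι) X ℂ)
    (ρ : Matrix X X ℂ) :
    applyKraus K (pauliChannel p (B * ρ * Bᴴ))
      = ∑ i : Pauli ι × A, ((∏ q, p (i.1 q) : ℝ) : ℂ)
          • (K i.2 * (pauliOp i.1 * B) * ρ * (K i.2 * (pauliOp i.1 * B))ᴴ) := by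
  rw [Fintype.sum_prod_type, Finset.sum_comm]
  refine Finset.sum_congr rfl fun a _ => ?_
  rw [pauliChannel, Matrix.mul_sum, Matrix.sum_mul]
  refine Finset.sum_congr rfl fun e _ => ?_
  rw [Matrix.mul_smul, Matrix.smul_mul]
  simp only [Matrix.conjTranspose_mul, pauliOp_conjTranspose, Matrix.mul_assoc]

open Classical in
/-- The fidelity of the scheme is at least the probability that the correction equals the logical
error up to a stabilizer of the outer code. -/
lemma fidelityAtLeast_concat {N n r k q m : ℕ} {C : StabilizerCode (Fin n) r}
    {p : Label → ℝ} (hp : ∀ a, 0 ≤ p a) (T : Tableau C k)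
    {V : Matrix (Bits (Fin n)) (Bits (Fin k)) ℂ} (hV : T.IsEncoder V)
    {D : StabilizerCode (Fin N × Fin k) q} {W : Matrix (Bits (Fin N × Fin k)) (Bits (Fin m)) ℂ}
    (hW : D.IsEncoder W)
    (c : (Fin N → Fin r → ZMod 2) → (Fin q → ZMod 2) → Pauli (Fin N × Fin k)) :
    FidelityAtLeast
      (fun ρ => applyKraus (concatDecoder T V W c)
        (pauliChannel p (concatEncoder V W * ρ * (concatEncoder V W)ᴴ)))
      (∑ l : Pauli (Fin N × Fin k), ∑ s : Fin N → Fin r → ZMod 2,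
        if c s (D.syndrome l) + l ∈ Submodule.span (ZMod 2) (Set.range D.gen)
        then T.blockJoint p l s else 0) := by
  let good : Finset ((Fin N → Fin r → ZMod 2) × Pauli (Fin N × Fin k)
      × (Fin N → Fin r → ZMod 2)) := Finset.univ.filter fun a =>
    c a.2.2 (D.syndrome a.2.1) + a.2.1 ∈ Submodule.span (ZMod 2) (Set.range D.gen)
  -- Of all pairs of an error and a decoder branch, only those are kept where the branch carries the
  -- true syndromes of the error. Injectivity ensures that no term is counted twice.
  let g : ((Fin N → Fin r → ZMod 2) × Pauli (Fin N × Fin k) × (Fin N → Fin r → ZMod 2))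
      ↪ Pauli (Fin N × Fin n) × ((Fin N → Fin r → ZMod 2) × (Fin q → ZMod 2)) :=
    ⟨fun a => (T.blockAssemble a, (a.2.2, D.syndrome a.2.1)), fun a b h =>
      T.blockAssemble_injective N (congrArg Prod.fst h)⟩
  have key := fidelityAtLeast_of_phaseEq_one
    (w := fun i : Pauli (Fin N × Fin n) × ((Fin N → Fin r → ZMod 2) × (Fin q → ZMod 2)) =>
      ∏ j, p (i.1 j))
    (fun i => Finset.prod_nonneg fun _ _ => hp _)
    (applyKraus_pauliChannel p (concatDecoder T V W c) (concatEncoder V W)) (good.map g) (by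
      intro i hi
      obtain ⟨⟨t, l, s⟩, ha, rfl⟩ := Finset.mem_map.mp hi
      exact concatDecoder_recovers T hV hW c t l s _ (Finset.mem_filter.mp ha).2)
  convert key using 1
  symm
  rw [Finset.sum_map, Finset.sum_filter, Fintype.sum_prod_type, Finset.sum_comm,
    Fintype.sum_prod_type]
  refine Finset.sum_congr rfl fun l _ => Finset.sum_congr rfl fun s _ => ?_
  rw [← T.sum_prod_blockAssemble p l s]
  split_ifs with h
  · rfl
  · exact Finset.sum_const_zero

/-! ## Syndromes and counting of stabilizer codes -/

section Counting
variable {ι : Type} [Fintype ι] {q : ℕ}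

lemma StabilizerCode.ext_gen {D D' : StabilizerCode ι q} (h : D.gen = D'.gen) : D = D' := by
  cases D; cases D'; cases h; rfl

instance : Finite (StabilizerCode ι q) := by
  classical
  exact Finite.of_injective (fun D => D.gen) fun _ _ => StabilizerCode.ext_gen

instance : Fintype (StabilizerCode ι q) := Fintype.ofFinite _

/-- The syndrome as a linear map. -/
def StabilizerCode.syndromeLin (D : StabilizerCode ι q) :
    Pauli ι →ₗ[ZMod 2] (Fin q → ZMod 2) where
  toFun := D.syndrome
  map_add' e f := funext fun i => symp_add_left e f (D.gen i)
  map_smul' c e := funext fun i => symp_smul_left c e (D.gen i)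

/-- A proper range would be annihilated by a nonzero functional `f`. The combination of generators
with the coefficients of `f` would then commute with every Pauli, hence vanish, against
independence. -/
lemma StabilizerCode.syndromeLin_surjective [DecidableEq ι] (D : StabilizerCode ι q) :
    Function.Surjective D.syndromeLin := by
  rw [← LinearMap.range_eq_top]
  by_contra hne
  obtain ⟨f, hf, hle⟩ := Submodule.exists_le_ker_of_lt_top _ (lt_top_iff_ne_top.mpr hne)
  have hexp : ∀ σ : Fin q → ZMod 2, f σ = ∑ i, σ i * f (Pi.single i 1) := by
    intro σ
    conv_lhs => rw [← Finset.univ_sum_single σ]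
    rw [map_sum]
    refine Finset.sum_congr rfl fun i _ => ?_
    rw [← smul_eq_mul, ← map_smul, ← Pi.single_smul, smul_eq_mul, mul_one]
  have h0 : ∑ i, f (Pi.single i 1) • D.gen i = 0 := by
    refine eq_zero_of_symp_eq_zero fun e => ?_
    have h1 : f (D.syndromeLin e) = 0 := hle ⟨e, rfl⟩
    rw [hexp] at h1
    rw [symp_sum_left, ← h1]
    refine Finset.sum_congr rfl fun i _ => ?_
    rw [symp_smul_left, symp_comm, mul_comm]; rfl
  have h2 := Fintype.linearIndependent_iff.mp D.gen_indep _ h0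
  refine hf (LinearMap.ext fun σ => ?_)
  rw [hexp]
  simp [h2]

lemma StabilizerCode.finrank_ker_syndromeLin [DecidableEq ι] (D : StabilizerCode ι q) :
    q + Module.finrank (ZMod 2) (LinearMap.ker D.syndromeLin) = 2 * Fintype.card ι := by
  have h := LinearMap.finrank_range_add_finrank_ker D.syndromeLin
  rw [LinearMap.range_eq_top.mpr D.syndromeLin_surjective, finrank_top, Module.finrank_fin_fun,
    Module.finrank_pi_fintype] at h
  simpa [mul_comm] using h

lemma StabilizerCode.card_ker_mul [DecidableEq ι] (D : StabilizerCode ι q) :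
    (Finset.univ.filter fun e => D.syndrome e = 0).card * 2 ^ q = 4 ^ Fintype.card ι := by
  have h1 : (Finset.univ.filter fun e => D.syndrome e = 0).card
      = Nat.card (LinearMap.ker D.syndromeLin) := by
    rw [← Fintype.card_subtype, ← Nat.card_eq_fintype_card]
    rfl
  rw [h1, Module.natCard_eq_pow_finrank (K := ZMod 2), Nat.card_zmod, ← pow_add, add_comm,
    D.finrank_ker_syndromeLin, pow_mul]
  norm_num

lemma StabilizerCode.span_le_ker (D : StabilizerCode ι q) :
    Submodule.span (ZMod 2) (Set.range D.gen) ≤ LinearMap.ker D.syndromeLin := by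
  rw [Submodule.span_le]
  rintro _ ⟨i, rfl⟩
  exact funext fun j => D.gen_comm i j

/-- A stabilizer group of full rank is its own commutant. -/
lemma StabilizerCode.mem_span_of_syndrome_eq_zero [DecidableEq ι] (D : StabilizerCode ι q)
    (hq : q = Fintype.card ι) {e : Pauli ι} (he : D.syndrome e = 0) :
    e ∈ Submodule.span (ZMod 2) (Set.range D.gen) := by
  -- The span lies in the commutant, and both have dimension `q = 2 * q - q`.
  have h := Submodule.eq_of_le_of_finrank_eq D.span_le_ker (by
    have h1 := D.finrank_ker_syndromeLin
    rw [finrank_span_eq_card D.gen_indep, Fintype.card_fin]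
    omega)
  rw [h]
  exact he

/-- The operators `Z` on `q` distinct qubits form such a code. Without any code, a bound on the
fraction of good codes would not yield one. -/
lemma StabilizerCode.nonempty_of_le [DecidableEq ι] (hq : q ≤ Fintype.card ι) :
    Nonempty (StabilizerCode ι q) := by
  let f : Fin q → ι := fun i => (Fintype.equivFin ι).symm (Fin.castLE hq i)
  have hf : Function.Injective f :=
    (Fintype.equivFin ι).symm.injective.comp (Fin.castLE_injective hq)
  refine ⟨⟨fun i => Pi.single (f i) (0, 1), fun i j => ?_, ?_⟩⟩
  · rw [symp_single]
    by_cases h : f j = f i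
    · rw [h]; simp
    · simp [Pi.single_eq_of_ne h]
  · rw [Fintype.linearIndependent_iff]
    intro g hg i
    have h1 := congrFun hg (f i)
    rw [Finset.sum_apply, Finset.sum_eq_single i] at h1
    · simpa using congrArg Prod.snd h1
    · intro j _ hj
      rw [Pi.smul_apply, Pi.single_eq_of_ne (hf.ne hj.symm), smul_zero]
    · simp

/-- Symplectic transvections. -/
def transvection (u : Pauli ι) : Pauli ι ≃ₗ[ZMod 2] Pauli ι :=
  LinearEquiv.ofInvolutive
    { toFun := fun x => x + symp x u • u
      map_add' := by
        intro x y
        rw [symp_add_left, add_smul]; abel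
      map_smul' := by
        intro c x
        rw [symp_smul_left, RingHom.id_apply, smul_add, smul_smul] }
    (by
      intro x
      change x + symp x u • u + symp (x + symp x u • u) u • u = x
      rw [symp_add_left, symp_smul_left, symp_self, mul_zero, add_zero, add_assoc, ← add_smul,
        CharTwo.add_self_eq_zero, zero_smul, add_zero])

lemma transvection_apply (u x : Pauli ι) : transvection u x = x + symp x u • u := rfl

lemma symp_transvection (u x y : Pauli ι) :
    symp (transvection u x) (transvection u y) = symp x y := by
  simp only [transvection_apply, symp_add_left, symp_add_right, symp_smul_left, symp_smul_right,
    symp_self, symp_comm u y]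
  have h : symp y u * symp x u + symp x u * symp y u = 0 := by
    rw [mul_comm]; exact CharTwo.add_self_eq_zero _
  linear_combination h

lemma transvection_transvection (u x : Pauli ι) : transvection u (transvection u x) = x :=
  (transvection u).left_inv x

/-- The image of a stabilizer code under a transvection. -/
def StabilizerCode.transvect (u : Pauli ι) (D : StabilizerCode ι q) : StabilizerCode ι q where
  gen i := transvection u (D.gen i)
  gen_comm i j := by rw [symp_transvection, D.gen_comm]
  gen_indep := D.gen_indep.map' (transvection u).toLinearMap (transvection u).ker

/-- The set of codes that do not detect the error `v`. -/
def undetecting [DecidableEq ι] (q : ℕ) (v : Pauli ι) : Finset (StabilizerCode ι q) :=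
  Finset.univ.filter fun D => D.syndrome v = 0

/-- A transvection preserves `symp`, so moving the code along with the error preserves the syndrome,
and it does so injectively. -/
lemma card_undetecting_le_transvection [DecidableEq ι] (u v : Pauli ι) :
    (undetecting q v).card ≤ (undetecting q (transvection u v)).card := by
  refine Finset.card_le_card_of_injOn (StabilizerCode.transvect u) ?_ ?_
  · intro D hD
    simp only [undetecting, Finset.coe_filter, Finset.mem_univ, true_and, Set.mem_ofPred_eq]
      at hD ⊢
    rw [← hD]
    exact funext fun i => symp_transvection _ _ _
  · intro D _ D' _ h
    refine StabilizerCode.ext_gen (funext fun i => (transvection u).injective ?_)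
    exact congrFun (congrArg StabilizerCode.gen h) i

lemma card_undetecting_transvection [DecidableEq ι] (u v : Pauli ι) :
    (undetecting q (transvection u v)).card = (undetecting q v).card := by
  refine le_antisymm ?_ (card_undetecting_le_transvection u v)
  have := card_undetecting_le_transvection (q := q) u (transvection u v)
  rwa [transvection_transvection] at this

lemma transvection_add_of_symp_eq_one {v w : Pauli ι} (h : symp v w = 1) :
    transvection (v + w) v = w := by
  rw [transvection_apply, symp_add_right, symp_self, h, zero_add, one_smul, ← add_assoc,
    ZModModule.add_self, zero_add]

lemma exists_symp_eq_one [DecidableEq ι] {v : Pauli ι} (hv : v ≠ 0) : ∃ a, symp v a = 1 := by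
  by_contra! h
  exact hv (eq_zero_of_symp_eq_zero fun f => (zmod_two_cases _).resolve_right (h f))

/-- If a partner `a` of `v` commutes with `w`, and a partner `b` of `w` commutes with `v`, then `a +
b` anticommutes with both. -/
lemma exists_common_symp_eq_one [DecidableEq ι] {v w : Pauli ι} (hv : v ≠ 0) (hw : w ≠ 0) :
    ∃ a, symp v a = 1 ∧ symp w a = 1 := by
  obtain ⟨a, ha⟩ := exists_symp_eq_one hv
  obtain ⟨b, hb⟩ := exists_symp_eq_one hw
  rcases zmod_two_cases (symp w a) with h1 | h1
  · rcases zmod_two_cases (symp v b) with h2 | h2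
    · exact ⟨a + b, by rw [symp_add_right, ha, h2, add_zero],
        by rw [symp_add_right, h1, hb, zero_add]⟩
    · exact ⟨b, h2, hb⟩
  · exact ⟨a, ha, h1⟩

/-- Transitivity in two steps: one transvection takes `v` to an `a` that anticommutes with both
Paulis, a second one takes `a` to `w`. -/
lemma card_undetecting_eq [DecidableEq ι] {v w : Pauli ι} (hv : v ≠ 0) (hw : w ≠ 0) :
    (undetecting q v).card = (undetecting q w).card := by
  obtain ⟨a, h1, h2⟩ := exists_common_symp_eq_one hv hw
  rw [← transvection_add_of_symp_eq_one ((symp_comm a w).trans h2),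
    card_undetecting_transvection, ← transvection_add_of_symp_eq_one h1,
    card_undetecting_transvection]

/-- At most a fraction `2 ^ (-q)` of all stabilizer codes with `q` generators fails to detect a
given nontrivial Pauli error. -/
lemma card_undetecting_mul_le [DecidableEq ι] {v : Pauli ι} (hv : v ≠ 0) :
    (undetecting q v).card * 2 ^ q ≤ Fintype.card (StabilizerCode ι q) := by
  -- Double counting of the pairs of a code and a Pauli that it fails to detect.
  have h1 : ∑ w : Pauli ι, (undetecting q w).card
      = ∑ D : StabilizerCode ι q, (Finset.univ.filter fun e => D.syndrome e = 0).card := by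
    simp only [undetecting, Finset.card_filter]
    exact Finset.sum_comm
  have h2 : ∑ w : Pauli ι, (undetecting q w).card
      = Fintype.card (StabilizerCode ι q)
        + (4 ^ Fintype.card ι - 1) * (undetecting q v).card := by
    rw [← Finset.add_sum_erase _ _ (Finset.mem_univ (0 : Pauli ι))]
    congr 1
    · rw [undetecting, Finset.filter_true_of_mem]
      · rfl
      · intro D _
        exact funext fun i => symp_zero_left _
    · rw [Finset.sum_congr rfl fun w hw => card_undetecting_eq (Finset.ne_of_mem_erase hw) hv,
        Finset.sum_const, Finset.card_erase_of_mem (Finset.mem_univ _), Finset.card_univ,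
        smul_eq_mul]
      simp
  have h3 : (∑ w : Pauli ι, (undetecting q w).card) * 2 ^ q
      = Fintype.card (StabilizerCode ι q) * 4 ^ Fintype.card ι := by
    rw [h1, Finset.sum_mul, Finset.sum_congr rfl fun D _ => StabilizerCode.card_ker_mul D,
      Finset.sum_const, Finset.card_univ, smul_eq_mul]
  rw [h2] at h3
  have hcard : 1 < 4 ^ Fintype.card ι := by
    obtain ⟨i, -⟩ := Function.ne_iff.mp hv
    exact Nat.one_lt_pow (Fintype.card_pos_iff.mpr ⟨i⟩).ne' (by norm_num)
  obtain ⟨M, hM⟩ : ∃ M, 4 ^ Fintype.card ι = M + 1 := ⟨_, (Nat.sub_add_cancel hcard.le).symm⟩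
  rw [hM, Nat.add_sub_cancel] at h3
  have hMpos : 0 < M := by omega
  -- With `K` codes and `a` of them missing `v`, `h3` reads `(K + M a) 2 ^ q = K (M + 1)`, and `K ≤
  -- K 2 ^ q`.
  have h4 : M * ((undetecting q v).card * 2 ^ q) ≤ M * Fintype.card (StabilizerCode ι q) := by
    have h5 : Fintype.card (StabilizerCode ι q) ≤ Fintype.card (StabilizerCode ι q) * 2 ^ q :=
      Nat.le_mul_of_pos_right _ (by positivity)
    nlinarith
  exact Nat.le_of_mul_le_mul_left h4 hMpos

end Counting

/-! ## A weak law of large numbers on finite product spaces -/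

section Chebyshev
variable {α : Type} [Fintype α]

lemma sum_fin_succ_fun {N : ℕ} (F : (Fin (N + 1) → α) → ℝ) :
    ∑ x, F x = ∑ a, ∑ x : Fin N → α, F (Fin.cons a x) := by
  rw [← (Fin.consEquiv fun _ : Fin (N + 1) => α).sum_comp, Fintype.sum_prod_type]
  rfl

variable {P : α → ℝ} {f : α → ℝ}

lemma sum_prod_eq_one (hP : ∑ a, P a = 1) (N : ℕ) : ∑ x : Fin N → α, ∏ b, P (x b) = 1 := by
  classical
  rw [← Fintype.piFinset_univ, ← Finset.prod_univ_sum]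
  simp [hP]

lemma sum_prod_mul_sum_eq_zero (hP : ∑ a, P a = 1) (hf : ∑ a, P a * f a = 0) (N : ℕ) :
    ∑ x : Fin N → α, (∏ b, P (x b)) * ∑ b, f (x b) = 0 := by
  induction N with
  | zero => simp
  | succ N ih =>
    rw [sum_fin_succ_fun]
    have h : ∀ (a : α) (x : Fin N → α),
        (∏ b, P ((Fin.cons a x : Fin (N + 1) → α) b)) * ∑ b, f ((Fin.cons a x : Fin (N + 1) → α) b)
          = P a * f a * ∏ b, P (x b) + P a * ((∏ b, P (x b)) * ∑ b, f (x b)) := by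
      intro a x
      rw [Fin.prod_univ_succ, Fin.sum_univ_succ]
      simp only [Fin.cons_zero, Fin.cons_succ]
      ring
    simp only [h, Finset.sum_add_distrib, ← Finset.mul_sum, ih, sum_prod_eq_one hP, mul_one,
      mul_zero, hf, add_zero]

/-- Variances of independent variables add: on splitting off the first coordinate, the cross term
vanishes because `f` is centred. -/
lemma sum_prod_mul_sum_sq (hP : ∑ a, P a = 1) (hf : ∑ a, P a * f a = 0) (N : ℕ) :
    ∑ x : Fin N → α, (∏ b, P (x b)) * (∑ b, f (x b)) ^ 2 = N * ∑ a, P a * f a ^ 2 := by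
  induction N with
  | zero => simp
  | succ N ih =>
    rw [sum_fin_succ_fun]
    have h : ∀ (a : α) (x : Fin N → α),
        (∏ b, P ((Fin.cons a x : Fin (N + 1) → α) b))
            * (∑ b, f ((Fin.cons a x : Fin (N + 1) → α) b)) ^ 2
          = P a * f a ^ 2 * ∏ b, P (x b) + 2 * (P a * f a) * ((∏ b, P (x b)) * ∑ b, f (x b))
            + P a * ((∏ b, P (x b)) * (∑ b, f (x b)) ^ 2) := by
      intro a x
      rw [Fin.prod_univ_succ, Fin.sum_univ_succ]
      simp only [Fin.cons_zero, Fin.cons_succ]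
      ring
    simp only [h, Finset.sum_add_distrib, ← Finset.mul_sum, ih, sum_prod_eq_one hP, mul_one,
      mul_zero, sum_prod_mul_sum_eq_zero hP hf, add_zero, ← Finset.sum_mul, hP]
    push_cast
    ring

open Classical in
/-- Chebyshev's inequality for a sum of independent centred variables. -/
lemma sum_prod_of_lt_sum_le (hP0 : ∀ a, 0 ≤ P a) (hP : ∑ a, P a = 1) (hf : ∑ a, P a * f a = 0)
    {N : ℕ} (hN : 0 < N) {δ : ℝ} (hδ : 0 < δ) :
    ∑ x : Fin N → α, (if N * δ < ∑ b, f (x b) then ∏ b, P (x b) else 0)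
      ≤ (∑ a, P a * f a ^ 2) / (N * δ ^ 2) := by
  have hN' : (0 : ℝ) < N := Nat.cast_pos.mpr hN
  have hle : ∑ x : Fin N → α, (N * δ) ^ 2 * (if N * δ < ∑ b, f (x b) then ∏ b, P (x b) else 0)
      ≤ N * ∑ a, P a * f a ^ 2 := by
    rw [← sum_prod_mul_sum_sq hP hf]
    refine Finset.sum_le_sum fun x _ => ?_
    have hx : 0 ≤ ∏ b, P (x b) := Finset.prod_nonneg fun _ _ => hP0 _
    split_ifs with h
    · rw [mul_comm]
      refine mul_le_mul_of_nonneg_left ?_ hx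
      exact pow_le_pow_left₀ (by positivity) h.le 2
    · rw [mul_zero]; positivity
  rw [← Finset.mul_sum] at hle
  rw [le_div_iff₀ (by positivity)]
  have : N * ((∑ x : Fin N → α, (if N * δ < ∑ b, f (x b) then ∏ b, P (x b) else 0)) * (N * δ ^ 2))
      ≤ N * ∑ a, P a * f a ^ 2 := by
    refine le_trans (le_of_eq ?_) hle
    ring
  exact le_of_mul_le_mul_left this hN'

end Chebyshev

/-! ## Typical logical errors -/

namespace Tableau
variable {n r k : ℕ} {C : StabilizerCode (Fin n) r} {p : Label → ℝ}

lemma joint_le_marginal (T : Tableau C k) (hp : ∀ a, 0 ≤ p a) (l : Pauli (Fin k))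
    (s : Fin r → ZMod 2) : T.joint p l s ≤ T.marginal p s :=
  Finset.single_le_sum (f := fun l => T.joint p l s) (fun l _ => T.joint_nonneg hp l s)
    (Finset.mem_univ l)

lemma marginal_nonneg (T : Tableau C k) (hp : ∀ a, 0 ≤ p a) (s : Fin r → ZMod 2) :
    0 ≤ T.marginal p s :=
  Finset.sum_nonneg fun l _ => T.joint_nonneg hp l s

/-- Conditional probabilities are at most one. For syndromes of probability zero the quotient is `0
/ 0 = 0`, and `logb 2 0 = 0` is harmless. -/
lemma condEntropy_nonneg (T : Tableau C k) (hp : ∀ a, 0 ≤ p a) : 0 ≤ T.condEntropy p := by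
  rw [condEntropy, neg_nonneg]
  refine Finset.sum_nonpos fun s _ => Finset.sum_nonpos fun l _ => ?_
  refine mul_nonpos_of_nonneg_of_nonpos (T.joint_nonneg hp l s) ?_
  exact Real.logb_nonpos one_lt_two (div_nonneg (T.joint_nonneg hp l s) (T.marginal_nonneg hp s))
    (div_le_one_of_le₀ (T.joint_le_marginal hp l s) (T.marginal_nonneg hp s))

/-- The centred information content of a logical error given the syndrome. -/
def infoDeviation (T : Tableau C k) (p : Label → ℝ) (a : Pauli (Fin k) × (Fin r → ZMod 2)) : ℝ :=
  -Real.logb 2 (T.joint p a.1 a.2 / T.marginal p a.2) - T.condEntropy p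

/-- The variance of the information content of the logical error given the syndrome. -/
def infoVariance (T : Tableau C k) (p : Label → ℝ) : ℝ :=
  ∑ a : Pauli (Fin k) × (Fin r → ZMod 2), T.joint p a.1 a.2 * T.infoDeviation p a ^ 2

/-- The mean of the information content is the conditional entropy by definition; the default values
of the logarithm carry weight zero. -/
lemma sum_joint_mul_infoDeviation (T : Tableau C k) (hr : r + k = n) (hp : ∑ a, p a = 1) :
    ∑ a : Pauli (Fin k) × (Fin r → ZMod 2), T.joint p a.1 a.2 * T.infoDeviation p a = 0 := by
  simp only [infoDeviation, mul_sub, mul_neg, Finset.sum_sub_distrib, ← Finset.sum_mul,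
    Finset.sum_neg_distrib]
  rw [Fintype.sum_prod_type (f := fun a : Pauli (Fin k) × (Fin r → ZMod 2) => T.joint p a.1 a.2),
    T.sum_joint hr hp, one_mul, Fintype.sum_prod_type_right, sub_eq_zero]
  rfl

variable {N : ℕ}

lemma blockJoint_nonneg (T : Tableau C k) (hp : ∀ a, 0 ≤ p a) (l : Pauli (Fin N × Fin k))
    (s : Fin N → Fin r → ZMod 2) : 0 ≤ T.blockJoint p l s :=
  Finset.prod_nonneg fun _ _ => T.joint_nonneg hp _ _

/-- Regrouping the logical Pauli and the syndrome of all blocks by blocks. -/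
def blockEquiv (N r k : ℕ) : (Fin N → Pauli (Fin k) × (Fin r → ZMod 2)) ≃
    Pauli (Fin N × Fin k) × (Fin N → Fin r → ZMod 2) :=
  (Equiv.arrowProdEquivProdArrow _ _ _).trans
    (Equiv.prodCongr (Equiv.curry _ _ _).symm (Equiv.refl _))

lemma sum_sum_eq_sum_blocks (F : Pauli (Fin N × Fin k) → (Fin N → Fin r → ZMod 2) → ℝ) :
    ∑ l, ∑ s, F l s = ∑ x : Fin N → Pauli (Fin k) × (Fin r → ZMod 2),
      F (fun q => (x q.1).1 q.2) (fun b => (x b).2) := by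
  rw [← Fintype.sum_prod_type' F, ← (blockEquiv N r k).sum_comp]
  rfl

lemma sum_blockJoint (T : Tableau C k) (hr : r + k = n) (hp : ∑ a, p a = 1) :
    ∑ l : Pauli (Fin N × Fin k), ∑ s, T.blockJoint p l s = 1 := by
  rw [sum_sum_eq_sum_blocks]
  refine sum_prod_eq_one (P := fun a : Pauli (Fin k) × (Fin r → ZMod 2) => T.joint p a.1 a.2) ?_ N
  rw [Fintype.sum_prod_type, T.sum_joint hr hp]

/-- The syndrome marginal of `N` blocks. -/
def blockMarginal (T : Tableau C k) (p : Label → ℝ) (s : Fin N → Fin r → ZMod 2) : ℝ :=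
  ∏ b, T.marginal p (s b)

lemma sum_blockJoint_eq_blockMarginal (T : Tableau C k) (s : Fin N → Fin r → ZMod 2) :
    ∑ l : Pauli (Fin N × Fin k), T.blockJoint p l s = T.blockMarginal p s := by
  simp only [blockMarginal, marginal, Finset.prod_univ_sum, Fintype.piFinset_univ]
  rw [← (Equiv.curry (Fin N) (Fin k) Label).symm.sum_comp]
  rfl

open Classical in
/-- The logical errors whose conditional probability given the syndromes `s` is at least `1 / θ`. -/
def typical (T : Tableau C k) (p : Label → ℝ) (θ : ℝ) (s : Fin N → Fin r → ZMod 2) :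
    Finset (Pauli (Fin N × Fin k)) :=
  Finset.univ.filter fun l => 0 < T.blockJoint p l s ∧ T.blockMarginal p s ≤ θ * T.blockJoint p l s

lemma mem_typical (T : Tableau C k) {θ : ℝ} {s : Fin N → Fin r → ZMod 2}
    {l : Pauli (Fin N × Fin k)} : l ∈ T.typical p θ s ↔
      0 < T.blockJoint p l s ∧ T.blockMarginal p s ≤ θ * T.blockJoint p l s := by
  simp [typical]

/-- Conditional probabilities of at least `1 / θ` each add up to at most one. -/
lemma card_typical_le (T : Tableau C k) (hp : ∀ a, 0 ≤ p a) {θ : ℝ} (hθ : 0 ≤ θ)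
    (s : Fin N → Fin r → ZMod 2) : ((T.typical p θ s).card : ℝ) ≤ θ := by
  rcases (T.typical p θ s).eq_empty_or_nonempty with h | ⟨l₀, hl₀⟩
  · rw [h]; simpa using hθ
  · have h1 : T.blockJoint p l₀ s ≤ T.blockMarginal p s := by
      rw [← sum_blockJoint_eq_blockMarginal]
      exact Finset.single_le_sum (f := fun l => T.blockJoint p l s)
        (fun l _ => T.blockJoint_nonneg hp l s) (Finset.mem_univ l₀)
    have hM : 0 < T.blockMarginal p s := (T.mem_typical.mp hl₀).1.trans_le h1
    have h2 : (T.typical p θ s).card * T.blockMarginal p s ≤ θ * T.blockMarginal p s := by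
      calc (T.typical p θ s).card * T.blockMarginal p s
          = ∑ l ∈ T.typical p θ s, T.blockMarginal p s := by rw [Finset.sum_const, nsmul_eq_mul]
        _ ≤ ∑ l ∈ T.typical p θ s, θ * T.blockJoint p l s :=
            Finset.sum_le_sum fun l hl => (T.mem_typical.mp hl).2
        _ ≤ ∑ l, θ * T.blockJoint p l s :=
            Finset.sum_le_sum_of_subset_of_nonneg (Finset.subset_univ _)
              fun l _ _ => mul_nonneg hθ (T.blockJoint_nonneg hp l s)
        _ = θ * T.blockMarginal p s := by rw [← Finset.mul_sum, sum_blockJoint_eq_blockMarginal]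
    exact le_of_mul_le_mul_right h2 hM

open Classical in
/-- Logical errors are typical with high probability. -/
lemma sum_atypical_le (T : Tableau C k) (hr : r + k = n) (hp : ∀ a, 0 ≤ p a)
    (hp1 : ∑ a, p a = 1) (hN : 0 < N) {δ : ℝ} (hδ : 0 < δ) :
    ∑ l : Pauli (Fin N × Fin k), ∑ s,
        (if l ∉ T.typical p (2 ^ (N * (T.condEntropy p + δ))) s then T.blockJoint p l s else 0)
      ≤ T.infoVariance p / (N * δ ^ 2) := by
  rw [sum_sum_eq_sum_blocks]
  refine le_trans ?_ (sum_prod_of_lt_sum_le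
    (P := fun a : Pauli (Fin k) × (Fin r → ZMod 2) => T.joint p a.1 a.2)
    (f := T.infoDeviation p) (fun a => T.joint_nonneg hp a.1 a.2)
    (by rw [Fintype.sum_prod_type, T.sum_joint hr hp1])
    (T.sum_joint_mul_infoDeviation hr hp1) hN hδ)
  refine Finset.sum_le_sum fun x _ => ?_
  have hJ : T.blockJoint p (fun q => (x q.1).1 q.2) (fun b => (x b).2)
      = ∏ b, T.joint p (x b).1 (x b).2 := rfl
  rw [hJ]
  have hnn : 0 ≤ ∏ b, T.joint p (x b).1 (x b).2 :=
    Finset.prod_nonneg fun _ _ => T.joint_nonneg hp _ _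
  -- Outcomes of probability zero contribute nothing; for the others all factors are positive and
  -- the logarithms are genuine.
  rcases hnn.eq_or_lt with h0 | hpos
  · rw [← h0]; simp
  · by_cases ht : N * δ < ∑ b, T.infoDeviation p (x b)
    · rw [if_pos ht]
      split_ifs
      · exact hnn
      · exact le_refl (∏ b, T.joint p (x b).1 (x b).2)
    · rw [if_neg ht, if_neg]
      rw [not_not, mem_typical, hJ]
      refine ⟨hpos, ?_⟩
      have hj : ∀ b, 0 < T.joint p (x b).1 (x b).2 := fun b =>
        (T.joint_nonneg hp _ _).lt_of_ne'
          (Finset.prod_ne_zero_iff.mp hpos.ne' b (Finset.mem_univ b))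
      have hm : ∀ b, 0 < T.marginal p (x b).2 := fun b =>
        (hj b).trans_le (T.joint_le_marginal hp _ _)
      have hMpos : 0 < T.blockMarginal p (fun b => (x b).2) :=
        Finset.prod_pos fun b _ => hm b
      -- By the product structure the deviations add up to the logarithm of the inverse conditional
      -- probability, minus its mean. A total of at most `N * δ` is thus exactly typicality.
      have hsum : ∑ b, T.infoDeviation p (x b)
          = Real.logb 2 (T.blockMarginal p (fun b => (x b).2) / ∏ b, T.joint p (x b).1 (x b).2)
            - N * T.condEntropy p := by
        simp only [infoDeviation, Finset.sum_sub_distrib, Finset.sum_const, Finset.card_univ,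
          Fintype.card_fin, nsmul_eq_mul]
        congr 1
        rw [blockMarginal, ← Finset.prod_div_distrib,
          Real.logb_prod _ _ fun b _ => (div_pos (hm b) (hj b)).ne']
        refine Finset.sum_congr rfl fun b _ => ?_
        rw [← Real.logb_inv, inv_div]
      rw [hsum, not_lt] at ht
      have h1 : T.blockMarginal p (fun b => (x b).2) / ∏ b, T.joint p (x b).1 (x b).2
          ≤ 2 ^ (N * (T.condEntropy p + δ)) := by
        rw [← Real.logb_le_iff_le_rpow one_lt_two (div_pos hMpos hpos)]
        linarith
      rwa [div_le_iff₀ hpos] at h1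

end Tableau

/-! ## Random outer codes -/

section Random
variable {N n r k q : ℕ} {C : StabilizerCode (Fin n) r} {p : Label → ℝ}

open Classical in
/-- A correction rule for the outer code `D`: a typical logical error with the given outer
syndrome, if there is one, and any Pauli with this syndrome otherwise. -/
def typicalCorrection (T : Tableau C k) (p : Label → ℝ) (θ : ℝ)
    (D : StabilizerCode (Fin N × Fin k) q) (s : Fin N → Fin r → ZMod 2) (σ : Fin q → ZMod 2) :
    Pauli (Fin N × Fin k) :=
  if h : ∃ l ∈ T.typical p θ s, D.syndrome l = σ then h.choose
  else (D.syndromeLin_surjective σ).choose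

lemma syndrome_typicalCorrection (T : Tableau C k) (θ : ℝ)
    (D : StabilizerCode (Fin N × Fin k) q) (s : Fin N → Fin r → ZMod 2) (σ : Fin q → ZMod 2) :
    D.syndrome (typicalCorrection T p θ D s σ) = σ := by
  unfold typicalCorrection
  split_ifs with h
  · exact h.choose_spec.2
  · exact (D.syndromeLin_surjective σ).choose_spec

lemma StabilizerCode.syndrome_add_eq_zero {D : StabilizerCode (Fin N × Fin k) q}
    {e f : Pauli (Fin N × Fin k)} (h : D.syndrome e = D.syndrome f) : D.syndrome (e + f) = 0 := by
  have : D.syndromeLin (e + f) = D.syndrome e + D.syndrome f := map_add _ _ _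
  rw [h, ZModModule.add_self] at this
  exact this

/-- A typical `l` is itself a candidate, so the search succeeds, and failure means that it returned
a different typical error with the same outer syndrome. -/
lemma typicalCorrection_failure (T : Tableau C k) {θ : ℝ}
    {D : StabilizerCode (Fin N × Fin k) q} {s : Fin N → Fin r → ZMod 2}
    {l : Pauli (Fin N × Fin k)} (hl : l ∈ T.typical p θ s)
    (hfail : typicalCorrection T p θ D s (D.syndrome l) + l
      ∉ Submodule.span (ZMod 2) (Set.range D.gen)) :
    ∃ l' ∈ (T.typical p θ s).erase l, D ∈ undetecting q (l' + l) := by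
  have h : ∃ l' ∈ T.typical p θ s, D.syndrome l' = D.syndrome l := ⟨l, hl, rfl⟩
  rw [typicalCorrection, dif_pos h] at hfail
  refine ⟨h.choose, Finset.mem_erase.mpr ⟨fun he => hfail ?_, h.choose_spec.1⟩, ?_⟩
  · rw [he, ZModModule.add_self]
    exact Submodule.zero_mem _
  · exact Finset.mem_filter.mpr
      ⟨Finset.mem_univ _, StabilizerCode.syndrome_add_eq_zero h.choose_spec.2⟩

open Classical in
/-- The probability that the typical correction rule fails for the outer code `D`. -/
def failureProb (T : Tableau C k) (p : Label → ℝ) (θ : ℝ)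
    (D : StabilizerCode (Fin N × Fin k) q) : ℝ :=
  ∑ l : Pauli (Fin N × Fin k), ∑ s : Fin N → Fin r → ZMod 2,
    if typicalCorrection T p θ D s (D.syndrome l) + l
      ∈ Submodule.span (ZMod 2) (Set.range D.gen) then 0 else T.blockJoint p l s

lemma failureProb_nonneg (T : Tableau C k) (hp : ∀ a, 0 ≤ p a) (θ : ℝ)
    (D : StabilizerCode (Fin N × Fin k) q) : 0 ≤ failureProb T p θ D := by
  refine Finset.sum_nonneg fun l _ => Finset.sum_nonneg fun s _ => ?_
  split_ifs
  · exact le_rfl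
  · exact T.blockJoint_nonneg hp l s

/-- With a maximal stabilizer group, every Pauli of the right syndrome is a right correction. This
serves negative rates, where no logical qubit is sent. -/
lemma failureProb_eq_zero (T : Tableau C k) (hq : q = N * k) (θ : ℝ)
    (D : StabilizerCode (Fin N × Fin k) q) : failureProb T p θ D = 0 := by
  refine Finset.sum_eq_zero fun l _ => Finset.sum_eq_zero fun s _ => if_pos ?_
  exact D.mem_span_of_syndrome_eq_zero (by simpa using hq)
    (StabilizerCode.syndrome_add_eq_zero (syndrome_typicalCorrection T θ D s _))

lemma FidelityAtLeast.mono {X : Type} [Fintype X] {Φ : Matrix X X ℂ → Matrix X X ℂ} {f f' : ℝ}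
    (h : FidelityAtLeast Φ f) (hf : f' ≤ f) : FidelityAtLeast Φ f' :=
  fun d ψ hψ => hf.trans (h d ψ hψ)

lemma reliable_of_failureProb_le (hr : r + k = n) (hp : ∀ a, 0 ≤ p a) (hp1 : ∑ a, p a = 1)
    (T : Tableau C k) {V : Matrix (Bits (Fin n)) (Bits (Fin k)) ℂ} (hV : T.IsEncoder V)
    {m : ℕ} (hq : q + m = N * k) {θ ε : ℝ} {D : StabilizerCode (Fin N × Fin k) q}
    (h : failureProb T p θ D ≤ ε) : Reliable p T V m D ε := by
  obtain ⟨W, hW⟩ := D.exists_isEncoder (m := m) (by simpa using hq)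
  have hc := syndrome_typicalCorrection (p := p) T θ D
  refine ⟨W, typicalCorrection T p θ D, hW, hc,
    concatDecoder_isChannel T hr hV.1 hW hq _ hc, ?_⟩
  refine (fidelityAtLeast_concat hp T hV hW (typicalCorrection T p θ D)).mono ?_
  refine (sub_le_sub_left h 1).trans (le_of_eq ?_)
  rw [← T.sum_blockJoint (N := N) hr hp1, failureProb, ← Finset.sum_sub_distrib]
  refine Finset.sum_congr rfl fun l _ => ?_
  rw [← Finset.sum_sub_distrib]
  refine Finset.sum_congr rfl fun s _ => ?_
  split_ifs
  · rw [sub_zero]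
  · rw [sub_self]

/-- The failure probability averaged over all outer codes. -/
lemma sum_failureProb_le (hr : r + k = n) (hp : ∀ a, 0 ≤ p a) (hp1 : ∑ a, p a = 1)
    (T : Tableau C k) (hN : 0 < N) {δ : ℝ} (hδ : 0 < δ) :
    ∑ D : StabilizerCode (Fin N × Fin k) q,
        failureProb T p (2 ^ (N * (T.condEntropy p + δ))) D
      ≤ (T.infoVariance p / (N * δ ^ 2) + 2 ^ (N * (T.condEntropy p + δ)) / 2 ^ q)
        * Fintype.card (StabilizerCode (Fin N × Fin k) q) := by
  classical
  set θ : ℝ := 2 ^ (N * (T.condEntropy p + δ)) with hθdef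
  have hθ : 0 ≤ θ := Real.rpow_nonneg zero_le_two _
  set K : ℝ := ((Fintype.card (StabilizerCode (Fin N × Fin k) q) : ℕ) : ℝ)
  have hK0 : 0 ≤ K := Nat.cast_nonneg _
  have hswap : ∑ D : StabilizerCode (Fin N × Fin k) q, failureProb T p θ D
      = ∑ l : Pauli (Fin N × Fin k), ∑ s : Fin N → Fin r → ZMod 2,
          ∑ D : StabilizerCode (Fin N × Fin k) q,
            if typicalCorrection T p θ D s (D.syndrome l) + l
              ∈ Submodule.span (ZMod 2) (Set.range D.gen) then 0 else T.blockJoint p l s := by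
    simp only [failureProb]
    rw [Finset.sum_comm]
    exact Finset.sum_congr rfl fun l _ => Finset.sum_comm
  -- An atypical `l` is charged in full for all `K` codes. For a typical one, a union bound runs
  -- over the at most `θ` competitors `l'`, each confused with `l` by at most `K / 2 ^ q` codes.
  have hterm : ∀ (l : Pauli (Fin N × Fin k)) (s : Fin N → Fin r → ZMod 2),
      (∑ D : StabilizerCode (Fin N × Fin k) q,
        if typicalCorrection T p θ D s (D.syndrome l) + l
          ∈ Submodule.span (ZMod 2) (Set.range D.gen) then 0 else T.blockJoint p l s)
      ≤ K * (if l ∉ T.typical p θ s then T.blockJoint p l s else 0)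
        + T.blockJoint p l s * (θ / 2 ^ q * K) := by
    intro l s
    have hJ := T.blockJoint_nonneg hp l s
    by_cases hl : l ∈ T.typical p θ s
    · rw [if_neg (not_not.mpr hl), mul_zero, zero_add]
      have h1 : ∀ D : StabilizerCode (Fin N × Fin k) q,
          (if typicalCorrection T p θ D s (D.syndrome l) + l
            ∈ Submodule.span (ZMod 2) (Set.range D.gen) then 0 else T.blockJoint p l s)
          ≤ T.blockJoint p l s * ∑ l' ∈ (T.typical p θ s).erase l,
              if D ∈ undetecting q (l' + l) then 1 else 0 := by
        intro D
        have hnn : ∀ l' ∈ (T.typical p θ s).erase l,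
            (0 : ℝ) ≤ if D ∈ undetecting q (l' + l) then 1 else 0 := by
          intro l' _; split_ifs <;> norm_num
        split_ifs with h
        · exact mul_nonneg hJ (Finset.sum_nonneg hnn)
        · obtain ⟨l', hl', hD⟩ := typicalCorrection_failure T hl h
          refine le_mul_of_one_le_right hJ ?_
          refine le_trans (le_of_eq ?_) (Finset.single_le_sum hnn hl')
          rw [if_pos hD]
      refine (Finset.sum_le_sum fun D _ => h1 D).trans ?_
      rw [← Finset.mul_sum, Finset.sum_comm]
      refine mul_le_mul_of_nonneg_left ?_ hJ
      have h2 : ∀ l' ∈ (T.typical p θ s).erase l,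
          (∑ D : StabilizerCode (Fin N × Fin k) q,
            if D ∈ undetecting q (l' + l) then (1 : ℝ) else 0) ≤ K / 2 ^ q := by
        intro l' hl'
        have hne : l' + l ≠ 0 := fun h0 =>
          Finset.ne_of_mem_erase hl' (by rw [← sub_eq_zero, ZModModule.sub_eq_add, h0])
        rw [Finset.sum_boole, Finset.filter_univ_mem, le_div_iff₀ (by positivity)]
        have h3 : (((undetecting q (l' + l)).card * 2 ^ q : ℕ) : ℝ) ≤ K :=
          Nat.cast_le.mpr (card_undetecting_mul_le hne)
        push_cast at h3
        exact h3
      refine (Finset.sum_le_sum h2).trans ?_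
      rw [Finset.sum_const, nsmul_eq_mul, div_mul_eq_mul_div, ← mul_div_assoc]
      refine div_le_div_of_nonneg_right (mul_le_mul_of_nonneg_right ?_ hK0) (by positivity)
      exact (Nat.cast_le.mpr (Finset.card_erase_le)).trans (T.card_typical_le hp hθ s)
    · rw [if_pos hl]
      refine le_trans ?_ (le_add_of_nonneg_right (by positivity))
      refine (Finset.sum_le_sum (g := fun _ => T.blockJoint p l s) fun D _ => ?_).trans
        (le_of_eq ?_)
      · split_ifs
        · exact hJ
        · exact le_rfl
      · rw [Finset.sum_const, Finset.card_univ, nsmul_eq_mul]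
  rw [hswap]
  refine (Finset.sum_le_sum fun l _ => Finset.sum_le_sum fun s _ => hterm l s).trans ?_
  simp only [Finset.sum_add_distrib, ← Finset.mul_sum, ← Finset.sum_mul]
  rw [T.sum_blockJoint hr hp1, one_mul, add_mul, mul_comm K]
  exact add_le_add_left (mul_le_mul_of_nonneg_right
    (T.sum_atypical_le hr hp hp1 hN hδ) hK0) _

open Classical in
/-- Markov's inequality for a finite average. -/
lemma one_sub_mul_card_le_card_filter {Ω : Type} [Fintype Ω] {F : Ω → ℝ} (hF : ∀ x, 0 ≤ F x)
    {ε : ℝ} (hε : 0 < ε) (h : ∑ x, F x ≤ ε ^ 2 * Fintype.card Ω) :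
    (1 - ε) * Fintype.card Ω ≤ (Finset.univ.filter fun x => F x ≤ ε).card := by
  have h1 : ε * (Finset.univ.filter fun x => ¬ F x ≤ ε).card ≤ ε ^ 2 * Fintype.card Ω := by
    calc ε * (Finset.univ.filter fun x => ¬ F x ≤ ε).card
        = ∑ x ∈ Finset.univ.filter (fun x => ¬ F x ≤ ε), ε := by
          rw [Finset.sum_const, nsmul_eq_mul, mul_comm]
      _ ≤ ∑ x ∈ Finset.univ.filter (fun x => ¬ F x ≤ ε), F x :=
          Finset.sum_le_sum fun x hx => (not_le.mp (Finset.mem_filter.mp hx).2).le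
      _ ≤ ∑ x, F x := Finset.sum_le_sum_of_subset_of_nonneg (Finset.subset_univ _)
          fun x _ _ => hF x
      _ ≤ _ := h
  have h2 : ((Finset.univ.filter fun x => ¬ F x ≤ ε).card : ℝ) ≤ ε * Fintype.card Ω := by
    refine le_of_mul_le_mul_left (h1.trans (le_of_eq ?_)) hε
    ring
  have h3 : ((Finset.univ.filter fun x => F x ≤ ε).card : ℝ)
      + (Finset.univ.filter fun x => ¬ F x ≤ ε).card = Fintype.card Ω := by
    exact_mod_cast Finset.card_filter_add_card_filter_not (s := (Finset.univ : Finset Ω))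
      (fun x => F x ≤ ε)
  linarith

/-- If the average failure probability is small, then most outer codes are reliable. -/
lemma reliable_of_sum_failureProb_le (hr : r + k = n) (hp : ∀ a, 0 ≤ p a) (hp1 : ∑ a, p a = 1)
    (T : Tableau C k) {V : Matrix (Bits (Fin n)) (Bits (Fin k)) ℂ} (hV : T.IsEncoder V)
    {m : ℕ} (hq : q + m = N * k) {θ ε η : ℝ} (hη : 0 < η) (hη1 : η < 1) (hηε : η ≤ ε)
    (h : ∑ D : StabilizerCode (Fin N × Fin k) q, failureProb T p θ D
      ≤ η ^ 2 * Fintype.card (StabilizerCode (Fin N × Fin k) q)) :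
    (∃ D : StabilizerCode (Fin N × Fin k) q, Reliable p T V m D ε) ∧
      (1 - ε) * Nat.card (StabilizerCode (Fin N × Fin k) q) ≤
        Nat.card {D : StabilizerCode (Fin N × Fin k) q // Reliable p T V m D ε} := by
  classical
  have h1 := one_sub_mul_card_le_card_filter (fun D => failureProb_nonneg T hp θ D) hη h
  have hrel : ∀ D : StabilizerCode (Fin N × Fin k) q, failureProb T p θ D ≤ η →
      Reliable p T V m D ε := fun D hD =>
    reliable_of_failureProb_le hr hp hp1 T hV hq (hD.trans hηε)
  have hpos : 0 < Fintype.card (StabilizerCode (Fin N × Fin k) q) :=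
    Fintype.card_pos_iff.mpr (StabilizerCode.nonempty_of_le (by simp; omega))
  constructor
  · have h2 : (0 : ℝ) < (Finset.univ.filter fun D : StabilizerCode (Fin N × Fin k) q =>
        failureProb T p θ D ≤ η).card :=
      (mul_pos (sub_pos.mpr hη1) (Nat.cast_pos.mpr hpos)).trans_le h1
    obtain ⟨D, hD⟩ := Finset.card_pos.mp (Nat.cast_pos.mp h2)
    exact ⟨D, hrel D (Finset.mem_filter.mp hD).2⟩
  · rw [Nat.card_eq_fintype_card, Nat.card_eq_fintype_card, Fintype.card_subtype]
    calc (1 - ε) * Fintype.card (StabilizerCode (Fin N × Fin k) q)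
        ≤ (1 - η) * Fintype.card (StabilizerCode (Fin N × Fin k) q) :=
          mul_le_mul_of_nonneg_right (by linarith) (Nat.cast_nonneg _)
      _ ≤ _ := h1
      _ ≤ _ := by
          refine Nat.cast_le.mpr (Finset.card_le_card fun D hD => ?_)
          exact Finset.mem_filter.mpr ⟨Finset.mem_univ _, hrel D (Finset.mem_filter.mp hD).2⟩

end Random

/-! ### The limit of many blocks and the choice of parameters. -/

open Filter Topology in
-- The two summands are the Chebyshev bound and the union bound; the `1` in the exponent pays for
-- rounding `m` up to an integer.
lemma eventually_error_bound_le (v : ℝ) {δ η : ℝ} (hδ : 0 < δ) (hη : 0 < η) :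
    ∀ᶠ N : ℕ in atTop, v / (N * δ ^ 2) + 2 ^ (1 - N * δ : ℝ) ≤ η := by
  have h1 : Tendsto (fun N : ℕ => v / (N * δ ^ 2)) atTop (𝓝 0) :=
    Tendsto.const_div_atTop
      (tendsto_natCast_atTop_atTop.atTop_mul_const (by positivity)) v
  have h2 : Tendsto (fun N : ℕ => (2 : ℝ) ^ (1 - N * δ : ℝ)) atTop (𝓝 0) := by
    have h3 : Tendsto (fun N : ℕ => (2 : ℝ) * ((2 : ℝ) ^ (-δ)) ^ N) atTop (𝓝 0) := by
      rw [← mul_zero (2 : ℝ)]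
      refine Tendsto.const_mul _ (tendsto_pow_atTop_nhds_zero_of_lt_one (by positivity) ?_)
      exact Real.rpow_lt_one_of_one_lt_of_neg one_lt_two (neg_neg_of_pos hδ)
    refine h3.congr fun N => ?_
    rw [← Real.rpow_natCast, ← Real.rpow_mul zero_le_two, sub_eq_add_neg,
      Real.rpow_add zero_lt_two, Real.rpow_one]
    congr 2
    ring
  have h4 := h1.add h2
  rw [add_zero] at h4
  exact h4.eventually (ge_mem_nhds hη)

end PauliHashing
end

theorem lemma1 {n k r : ℕ} (hn : 0 < n) (hr : r + k = n)
    (p : PauliHashing.Label → ℝ) (hp_nonneg : ∀ a, 0 ≤ p a) (hp_sum : ∑ a, p a = 1)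
    (C : PauliHashing.StabilizerCode (Fin n) r) (T : PauliHashing.Tableau C k)
    (R : ℝ) (hR : R < T.inducedRate p) :
    (∃ V, T.IsEncoder V) ∧
    ∀ V, T.IsEncoder V → ∀ ε : ℝ, 0 < ε →
      ∀ᶠ N : ℕ in Filter.atTop, ∃ m : ℕ, m ≤ N * k ∧ R * (N * n) ≤ m ∧
        (∃ D : PauliHashing.StabilizerCode (Fin N × Fin k) (N * k - m),
          PauliHashing.Reliable p T V m D ε) ∧
        (1 - ε) * Nat.card (PauliHashing.StabilizerCode (Fin N × Fin k) (N * k - m)) ≤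
          Nat.card {D : PauliHashing.StabilizerCode (Fin N × Fin k) (N * k - m) //
            PauliHashing.Reliable p T V m D ε} := by
  refine ⟨T.exists_isEncoder hr, fun V hV ε hε => ?_⟩
  have hn' : (0 : ℝ) < n := Nat.cast_pos.mpr hn
  have hgap : R * n < k - T.condEntropy p := by
    rwa [PauliHashing.Tableau.inducedRate, lt_div_iff₀ hn'] at hR
  have hH := T.condEntropy_nonneg hp_nonneg
  -- A mean failure probability of at most `η ^ 2` leaves, by Markov, a fraction `1 - η` of codes
  -- that fail with probability at most `η`. The condition `η < 1` keeps this fraction positive even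
  -- if `ε ≥ 1`.
  obtain ⟨η, hη, hη1, hηε⟩ : ∃ η : ℝ, 0 < η ∧ η < 1 ∧ η ≤ ε :=
    ⟨min ε (1 / 2), by positivity, (min_le_right _ _).trans_lt (by norm_num), min_le_left _ _⟩
  -- Half of the gap in rate is spent on typicality, the other half makes the union bound decay.
  obtain ⟨δ, hδ, hδ2⟩ : ∃ δ : ℝ, 0 < δ ∧ 2 * δ = k - T.condEntropy p - R * n :=
    ⟨(k - T.condEntropy p - R * n) / 2, by linarith, by ring⟩
  filter_upwards [Filter.eventually_gt_atTop 0,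
    PauliHashing.eventually_error_bound_le (T.infoVariance p) hδ (pow_pos hη 2)] with N hN hbound
  have hN' : (0 : ℝ) < N := Nat.cast_pos.mpr hN
  have hm : ⌈R * (N * n)⌉₊ ≤ N * k := by
    rw [Nat.ceil_le]
    push_cast
    nlinarith
  refine ⟨⌈R * (N * n)⌉₊, hm, Nat.le_ceil _, ?_⟩
  have hq : N * k - ⌈R * (N * n)⌉₊ + ⌈R * (N * n)⌉₊ = N * k := Nat.sub_add_cancel hm
  refine PauliHashing.reliable_of_sum_failureProb_le hr hp_nonneg hp_sum T hV hq
    (θ := 2 ^ (N * (T.condEntropy p + δ))) hη hη1 hηε ?_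
  -- For negative `R` the rounded `m` is `0` and `q` is only `N * k`, which may be smaller than `N *
  -- (H + δ)` since `δ` grows with `-R`. The code is then maximal and never fails.
  rcases lt_or_ge R 0 with hR0 | hR0
  · have h0 : ⌈R * (N * n)⌉₊ = 0 := Nat.ceil_eq_zero.mpr (by nlinarith [mul_pos hN' hn'])
    rw [Finset.sum_eq_zero fun D _ =>
      PauliHashing.failureProb_eq_zero T (by rw [h0, Nat.sub_zero]) _ D]
    positivity
  · refine (PauliHashing.sum_failureProb_le hr hp_nonneg hp_sum T hN hδ).trans ?_
    refine mul_le_mul_of_nonneg_right (le_trans ?_ hbound) (Nat.cast_nonneg _)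
    refine add_le_add_right ?_ _
    rw [← Real.rpow_natCast, ← Real.rpow_sub zero_lt_two]
    refine Real.rpow_le_rpow_of_exponent_le one_le_two ?_
    -- Hence `q > N * (H + 2 * δ) - 1`, and the exponent `N * (H + δ) - q` is below `1 - N * δ`.
    have hceil : (⌈R * (N * n)⌉₊ : ℝ) < R * (N * n) + 1 := Nat.ceil_lt_add_one (by positivity)
    rw [Nat.cast_sub hm]
    push_cast
    nlinarith
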